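/- **Definitions.** A partial action $\theta\colon G\curvearrowright X$ of a discrete group on a topological space consists of open sets $X_g\subset X$ and homeomorphisms $\theta_g\colon X_{g^{-1}}\to X_g$, $x\mapsto g.x$ ($g\in G$), with $\theta_1=\mathrm{id}_X$ and such that $\theta_{gh}$ extends $\theta_g\circ\theta_h$. For $U\subset X$ open (or invariant), $\theta|_U$ is the restricted partial action on $U$ with domains $U_g=\theta_g(U\cap X_{g^{-1}})\cap U$; $U$ is *$G$-full* if every point of $X$ is of the form $g.x$ with $x\in U\cap X_{g^{-1}}$. Partial actions $\theta\colon G\curvearrowright X$ and $\theta'\colon H\curvearrowright Y$ are *dynamically equivalent*, $\theta\approx\theta'$, if there are a homeomorphism $\varphi\colon X\to Y$ and continuous maps $a\colon\bigcup_g\{g\}\times X_{g^{-1}}\to H$, $b\colon\bigcup_h\{h\}\times Y_{h^{-1}}\to G$ such that, for all $g,g'\in G$, $h,h'\in H$, $x\in X_{g^{-1}}$, $y\in Y_{h^{-1}}$: (1) $\varphi(x)\in Y_{a(g,x)^{-1}}$ and $\varphi(g.x)=a(g,x).\varphi(x)$; (2) $\varphi^{-1}(y)\in X_{b(h,y)^{-1}}$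 and $\varphi^{-1}(h.y)=b(h,y).\varphi^{-1}(y)$; (3) $b(a(g,x),\varphi(x))=g$ and $a(b(h,y),\varphi^{-1}(y))=h$; (4) $a(g'g,x)=a(g',g.x)\,a(g,x)$ if $g.x\in X_{g'^{-1}}$; (5) $b(h'h,y)=b(h',h.y)\,b(h,y)$ if $h.y\in Y_{h'^{-1}}$. They are *Kakutani equivalent* if there are clopen sets $K\subset X$ and $K'\subset Y$, respectively $G$-full and $H$-full, with $\theta|_K\approx\theta'|_{K'}$. Let $A$ be a finite alphabet and $\mathbb F=\mathbb F(A)$ the free group on $A$, with word length $|\cdot|$. A set $\xi\subset\mathbb F$ is *right-convex* if for every reduced word $a_n^{\varepsilon_n}\cdots a_1^{\varepsilon_1}\in\xi$ also $a_m^{\varepsilon_m}\cdots a_1^{\varepsilon_1}\in\xi$ for all $m<n$. Let $\mathcal C(A)\subset\{0,1\}^{\mathbb F}$ be the space of right-convex sets containing $1$. The *full convex shift* is the partial action $\mathbb F\curvearrowright\mathcal C(A)$ in which $\alpha$ acts on $\xi$ exactly when $\alpha\in\xi$, and then $\alpha.\xi=\xi\cdot\alpha^{-1}$. A *convex subshift*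 is the restriction of the full convex shift to a closed invariant subspace $\Omega\subset\mathcal C(A)$. An *$n$-ball* is an element $B\in\mathcal C(A)$ with $|\alpha|\le n$ for all $\alpha\in B$, together with its radius $r(B)=n$; for $\xi\in\mathcal C(A)$ put $\xi^n=\{\alpha\in\xi:|\alpha|\le n\}$. The convex subshift is *of finite type* if there is a finite set $\mathcal F$ of balls such that $$\Omega=\{\xi\in\mathcal C(A) : (\alpha.\xi)^{r(B)}\neq B\text{ for all }B\in\mathcal F,\ \alpha\in\xi\}.$$ A *finite bipartite separated graph* $(E,C)$ is a finite directed graph $E=(E^0,E^1,r,s)$ with $E^0=E^{0,0}\sqcup E^{0,1}$, $r(E^1)=E^{0,0}$, $s(E^1)=E^{0,1}$, together with a partition $C_v$ of $r^{-1}(v)$ into non-empty sets for each $v\in E^0$. Let $\Omega(E,C)$ be the set of $\xi\in\mathcal C(E^1)$ such that for every $\alpha\in\xi$ the local configuration $\xi_\alpha=\{\sigma\in E^1\sqcup(E^1)^{-1} : \sigma\alpha\in\xi\}$ is either $s^{-1}(v)$ for some $v\in E^{0,1}$, or $\{e_X^{-1} : X\in C_v\}$ for some $v\in E^{0,0}$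 and some choice of $e_X\in X$. The *canonical partial action* $\theta^{(E,C)}$ is the restriction of the full convex shift $\mathbb F(E^1)\curvearrowright\mathcal C(E^1)$ to the invariant subspace $\Omega(E,C)$. **Theorem.** If $\theta\colon\mathbb F\curvearrowright\Omega$ is a convex subshift of finite type over a finite alphabet, then there is a finite bipartite separated graph $(E,C)$ such that $\theta^{(E,C)}$ and $\theta$ are Kakutani equivalent. -/

import Mathlib

universe u v w x

/-! ## Partial actions on topological spaces -/

/-- A topological partial action `θ` of a (discrete) group `G` on a space `X`.
`src g` is the open set on which `g` acts, that is, `X_{g⁻¹}`; hence `X_g` is `src g⁻¹`.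
`act g` maps `X_{g⁻¹}` into `X_g`. The axioms force `act g : X_{g⁻¹} → X_g` to be a homeomorphism
with inverse `act g⁻¹`, and `act (g * h)` to extend the composition `act g ∘ act h`. -/
structure PartialAction (G : Type u) (X : Type v) [Group G] [TopologicalSpace X] where
  src : G → Set X
  act : (g : G) → (x : X) → x ∈ src g → X
  isOpen_src : ∀ g, IsOpen (src g)
  continuous_act : ∀ g, Continuous fun x : src g => act g x.1 x.2
  act_mem : ∀ g x (hx : x ∈ src g), act g x hx ∈ src g⁻¹
  mem_src_one : ∀ x, x ∈ src 1
  act_one : ∀ x (hx : x ∈ src 1), act 1 x hx = x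
  mem_src_mul : ∀ g h x (hx : x ∈ src h), act h x hx ∈ src g → x ∈ src (g * h)
  act_mul : ∀ g h x (hx : x ∈ src h) (hy : act h x hx ∈ src g) (hz : x ∈ src (g * h)),
    act (g * h) x hz = act g (act h x hx) hy

namespace PartialAction

variable {G : Type u} {X : Type v} [Group G] [TopologicalSpace X]

/-- `U` is invariant: `g.x ∈ U` whenever `x ∈ U` and `g` can act on `x`. -/
def IsInvariant (θ : PartialAction G X) (U : Set X) : Prop :=
  ∀ g x (hx : x ∈ θ.src g), x ∈ U → θ.act g x hx ∈ U

/-- `U` is `G`-full: every point of `X` is of the form `g.x` with `x ∈ U`. -/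
def IsFull (θ : PartialAction G X) (U : Set X) : Prop :=
  ∀ y, ∃ g x, ∃ hx : x ∈ θ.src g, x ∈ U ∧ θ.act g x hx = y

/-- The points `x` of `U` on which `g` acts and for which `g.x` lies in `U` again. This is
`U_{g⁻¹} = θ_{g⁻¹}(U ∩ X_g) ∩ U`. -/
def restrictSrc (θ : PartialAction G X) (U : Set X) (g : G) : Set U :=
  {x | ∃ hx : x.1 ∈ θ.src g, θ.act g x.1 hx ∈ U}

theorem isOpen_restrictSrc_of_isOpen (θ : PartialAction G X) {U : Set X} (hU : IsOpen U) (g : G) :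
    IsOpen (θ.restrictSrc U g) := by
  have h1 : IsOpen ((fun x : θ.src g => θ.act g x.1 x.2) ⁻¹' U) :=
    hU.preimage (θ.continuous_act g)
  have h2 := (θ.isOpen_src g).isOpenMap_subtype_val _ h1
  convert h2.preimage (continuous_subtype_val : Continuous (Subtype.val : U → X)) using 1
  ext x
  simp [restrictSrc]

theorem isOpen_restrictSrc_of_isInvariant (θ : PartialAction G X) {U : Set X}
    (hU : θ.IsInvariant U) (g : G) : IsOpen (θ.restrictSrc U g) := by
  convert (θ.isOpen_src g).preimage (continuous_subtype_val : Continuous (Subtype.val : U → X))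
    using 1
  ext x
  exact ⟨fun h => h.1, fun h => ⟨h, hU g x.1 h x.2⟩⟩

/-- The restriction of a partial action to a subspace `U` on which the restricted domains are
(relatively) open; this holds when `U` is open, and when `U` is invariant. -/
def restrict (θ : PartialAction G X) (U : Set X) (hU : ∀ g, IsOpen (θ.restrictSrc U g)) :
    PartialAction G U where
  src := θ.restrictSrc U
  act g x hx := ⟨θ.act g x.1 hx.1, hx.2⟩
  isOpen_src := hU
  continuous_act g := by
    refine Continuous.subtype_mk ?_ _
    exact (θ.continuous_act g).comp
      (Continuous.subtype_mk (continuous_subtype_val.comp continuous_subtype_val)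
        (fun x : θ.restrictSrc U g => x.2.1))
  act_mem g x hx := by
    obtain ⟨h1, h2⟩ := hx
    have h3 := θ.act_mem g x.1 h1
    have h4 := θ.mem_src_mul g⁻¹ g x.1 h1 h3
    refine ⟨h3, ?_⟩
    rw [← θ.act_mul g⁻¹ g x.1 h1 h3 h4]
    have key : ∀ k (hk : x.1 ∈ θ.src k), k = 1 → θ.act k x.1 hk ∈ U := by
      rintro k hk rfl
      rw [θ.act_one]
      exact x.2
    exact key _ _ (inv_mul_cancel g)
  mem_src_one x := ⟨θ.mem_src_one x.1, by rw [θ.act_one]; exact x.2⟩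
  act_one x hx := Subtype.ext (θ.act_one x.1 hx.1)
  mem_src_mul g h x hx hy := by
    refine ⟨θ.mem_src_mul g h x.1 hx.1 hy.1, ?_⟩
    rw [θ.act_mul g h x.1 hx.1 hy.1]
    exact hy.2
  act_mul g h x hx hy hz := Subtype.ext (θ.act_mul g h x.1 hx.1 hy.1 hz.1)

/-- The restriction `θ|_U` to an open subspace. -/
def restrictOpen (θ : PartialAction G X) (U : Set X) (hU : IsOpen U) : PartialAction G U :=
  θ.restrict U (θ.isOpen_restrictSrc_of_isOpen hU)

/-- The restriction to an invariant subspace. -/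
def restrictInvariant (θ : PartialAction G X) (U : Set X) (hU : θ.IsInvariant U) :
    PartialAction G U :=
  θ.restrict U (θ.isOpen_restrictSrc_of_isInvariant hU)

end PartialAction

/-- A dynamical equivalence of partial actions of discrete groups `G` and `H`, that is, an
isomorphism of the topological transformation groupoids, spelled out: a homeomorphism `φ` and
continuous cocycles `a`, `b`. As `G` and `H` are discrete, continuity of
`a : ⋃ g, {g} × X_{g⁻¹} → H` means that each `a(g, -)` is locally constant. -/
structure DynamicalEquivalence {G : Type u} {X : Type v} {H : Type w} {Y : Type x}
    [Group G] [TopologicalSpace X] [Group H] [TopologicalSpace Y]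
    (θ : PartialAction G X) (η : PartialAction H Y) where
  φ : X ≃ₜ Y
  a : (g : G) → (x : X) → x ∈ θ.src g → H
  b : (h : H) → (y : Y) → y ∈ η.src h → G
  a_cont : ∀ g, IsLocallyConstant fun x : θ.src g => a g x.1 x.2
  b_cont : ∀ h, IsLocallyConstant fun y : η.src h => b h y.1 y.2
  map_act : ∀ g x (hx : x ∈ θ.src g), ∃ hy : φ x ∈ η.src (a g x hx),
    φ (θ.act g x hx) = η.act (a g x hx) (φ x) hy
  symm_map_act : ∀ h y (hy : y ∈ η.src h), ∃ hx : φ.symm y ∈ θ.src (b h y hy),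
    φ.symm (η.act h y hy) = θ.act (b h y hy) (φ.symm y) hx
  b_a : ∀ g x (hx : x ∈ θ.src g) (hy : φ x ∈ η.src (a g x hx)), b (a g x hx) (φ x) hy = g
  a_b : ∀ h y (hy : y ∈ η.src h) (hx : φ.symm y ∈ θ.src (b h y hy)),
    a (b h y hy) (φ.symm y) hx = h
  a_mul : ∀ g' g x (hx : x ∈ θ.src g) (hx' : θ.act g x hx ∈ θ.src g'),
    a (g' * g) x (θ.mem_src_mul g' g x hx hx') = a g' (θ.act g x hx) hx' * a g x hx
  b_mul : ∀ h' h y (hy : y ∈ η.src h) (hy' : η.act h y hy ∈ η.src h'),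
    b (h' * h) y (η.mem_src_mul h' h y hy hy') = b h' (η.act h y hy) hy' * b h y hy

/-- Kakutani equivalence: the restrictions to some full clopen subspaces are dynamically
equivalent. -/
def KakutaniEquivalent {G : Type u} {X : Type v} {H : Type w} {Y : Type x}
    [Group G] [TopologicalSpace X] [Group H] [TopologicalSpace Y]
    (θ : PartialAction G X) (η : PartialAction H Y) : Prop :=
  ∃ (K : Set X) (K' : Set Y) (hK : IsClopen K) (hK' : IsClopen K'),
    θ.IsFull K ∧ η.IsFull K' ∧
      Nonempty (DynamicalEquivalence (θ.restrictOpen K hK.isOpen) (η.restrictOpen K' hK'.isOpen))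

/-! ## Convex subshifts -/

/-- Right-convexity of `ξ ⊆ 𝔽(A)`: if a reduced word belongs to `ξ`, so does every terminal
segment. A word is a list of pairs `(a, ε)`, where `(a, true)` stands for `a` and `(a, false)` for
`a⁻¹`, and the head of the list is the leftmost letter. -/
def IsRightConvex {A : Type u} (ξ : Set (FreeGroup A)) : Prop :=
  ∀ L M : List (A × Bool), FreeGroup.IsReduced (L ++ M) →
    FreeGroup.mk (L ++ M) ∈ ξ → FreeGroup.mk M ∈ ξ

/-- The space `𝒞(A)` of right-convex subsets of `𝔽(A)` that contain `1`. -/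
structure ConvexConfig (A : Type u) where
  carrier : Set (FreeGroup A)
  one_mem : 1 ∈ carrier
  convex : IsRightConvex carrier

namespace ConvexConfig

variable {A : Type u}

@[ext] theorem ext {ξ η : ConvexConfig A} (h : ξ.carrier = η.carrier) : ξ = η := by
  cases ξ; cases η; simpa using h

/-- The topology of `{0,1}^𝔽(A)`. -/
noncomputable instance : TopologicalSpace (ConvexConfig A) :=
  TopologicalSpace.induced (fun ξ => ξ.carrier.boolIndicator) Pi.topologicalSpace

theorem continuous_boolIndicator (α : FreeGroup A) :
    Continuous fun ξ : ConvexConfig A => ξ.carrier.boolIndicator α := by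
  have h : Continuous fun ξ : ConvexConfig A => ξ.carrier.boolIndicator := continuous_induced_dom
  exact (continuous_apply α).comp h

theorem isClopen_mem (α : FreeGroup A) : IsClopen {ξ : ConvexConfig A | α ∈ ξ.carrier} := by
  convert (isClopen_discrete {true}).preimage (continuous_boolIndicator α) using 1
  ext ξ
  exact Set.mem_iff_boolIndicator _ _

theorem translate_letter {ξ : Set (FreeGroup A)} (h : IsRightConvex ξ)
    (s : A × Bool) (hs : FreeGroup.mk [s] ∈ ξ) :
    IsRightConvex {β | β * FreeGroup.mk [s] ∈ ξ} := by
  intro L M hred hmem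
  simp only [Set.mem_ofPred_eq, FreeGroup.mul_mk] at hmem ⊢
  rcases List.eq_nil_or_concat M with rfl | ⟨N, t, rfl⟩
  · simpa using hs
  · by_cases hst : t = (s.1, !s.2)
    · subst hst
      have e : ∀ P : List (A × Bool),
          FreeGroup.mk ((P ++ [(s.1, !s.2)]) ++ [s]) = FreeGroup.mk P := by
        intro P
        rw [← FreeGroup.mul_mk, ← FreeGroup.mul_mk, mul_assoc, FreeGroup.mul_mk]
        have h1 : FreeGroup.mk ([(s.1, !s.2)] ++ [s]) = 1 := by
          have := FreeGroup.Red.Step.not_rev (L₁ := []) (L₂ := []) (x := s.1) (b := s.2)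
          exact Quot.sound (by simpa using this)
        rw [h1, mul_one]
      rw [List.concat_eq_append] at *
      rw [e]
      rw [← List.append_assoc] at hred hmem
      rw [e] at hmem
      exact h L N (hred.infix ⟨[], [(s.1, !s.2)], by simp⟩) hmem
    · rw [List.concat_eq_append] at *
      refine h L (N ++ [t] ++ [s]) ?_ (by simpa using hmem)
      rw [← List.append_assoc] at hred
      have h2 : FreeGroup.IsReduced [t, s] := by
        rw [FreeGroup.isReduced_cons_cons]
        refine ⟨fun h1 => ?_, FreeGroup.IsReduced.singleton⟩
        by_contra h3
        apply hst
        ext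
        · exact h1
        · cases t; cases s; simp_all
      have h3 := FreeGroup.IsReduced.append_overlap (L₁ := L ++ N) (L₂ := [t]) (L₃ := [s])
        hred (by simpa using h2) (by simp)
      simpa using h3

theorem translate_mk (L : List (A × Bool)) : ∀ {ξ : Set (FreeGroup A)}, IsRightConvex ξ →
    FreeGroup.IsReduced L → FreeGroup.mk L ∈ ξ →
      IsRightConvex {β | β * FreeGroup.mk L ∈ ξ} := by
  induction L using List.reverseRecOn with
  | nil =>
    intro ξ h _ _
    simpa [← FreeGroup.one_eq_mk] using h
  | append_singleton M s ih =>
    intro ξ h hred hmem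
    have hs := h M [s] hred hmem
    have := ih (translate_letter h s hs) (hred.infix ⟨[], [s], by simp⟩)
      (by simpa [FreeGroup.mul_mk] using hmem)
    simpa only [Set.mem_ofPred_eq, mul_assoc, FreeGroup.mul_mk] using this

theorem translate_convex {ξ : Set (FreeGroup A)} (h : IsRightConvex ξ) {α : FreeGroup A}
    (hα : α ∈ ξ) : IsRightConvex {β | β * α ∈ ξ} := by
  classical
  have := translate_mk α.toWord h FreeGroup.isReduced_toWord
    (by rw [FreeGroup.mk_toWord]; exact hα)
  rwa [FreeGroup.mk_toWord] at this

/-- The translate `α.ξ = ξ · α⁻¹ = {β | β α ∈ ξ}`, for `α ∈ ξ`. -/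
def shift (ξ : ConvexConfig A) (α : FreeGroup A) (hα : α ∈ ξ.carrier) : ConvexConfig A where
  carrier := {β | β * α ∈ ξ.carrier}
  one_mem := by simpa using hα
  convex := translate_convex ξ.convex hα

/-- The `n`-ball `ξ^n = {α ∈ ξ | |α| ≤ n}`, where `|α|` is the length of the reduced word. -/
def trunc [DecidableEq A] (ξ : ConvexConfig A) (n : ℕ) : ConvexConfig A where
  carrier := {α | α ∈ ξ.carrier ∧ α.norm ≤ n}
  one_mem := ⟨ξ.one_mem, by simp⟩
  convex L M hred hmem := by
    refine ⟨ξ.convex L M hred hmem.1, le_trans ?_ hmem.2⟩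
    have hM : FreeGroup.IsReduced M := hred.infix ⟨L, [], by simp⟩
    rw [FreeGroup.norm, FreeGroup.norm, FreeGroup.toWord_mk, FreeGroup.toWord_mk,
      hM.reduce_eq, hred.reduce_eq]
    simp

end ConvexConfig

/-- The full convex shift `𝔽(A) ↷ 𝒞(A)`: `α` acts on `ξ` if and only if `α ∈ ξ`, and then
`α.ξ = ξ · α⁻¹`. -/
noncomputable def fullConvexShift (A : Type u) : PartialAction (FreeGroup A) (ConvexConfig A) where
  src α := {ξ | α ∈ ξ.carrier}
  act α ξ hα := ξ.shift α hα
  isOpen_src α := (ConvexConfig.isClopen_mem α).isOpen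
  continuous_act α := by
    refine continuous_induced_rng.2 (continuous_pi fun β => ?_)
    exact (ConvexConfig.continuous_boolIndicator (β * α)).comp continuous_subtype_val
  act_mem α ξ hα := by
    change α⁻¹ * α ∈ ξ.carrier
    simpa using ξ.one_mem
  mem_src_one ξ := ξ.one_mem
  act_one ξ hξ := by
    ext β
    change β * 1 ∈ ξ.carrier ↔ _
    rw [mul_one]
  mem_src_mul α β ξ hβ h := h
  act_mul α β ξ hβ h h' := by
    ext γ
    change γ * (α * β) ∈ ξ.carrier ↔ γ * α * β ∈ ξ.carrier
    rw [mul_assoc]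

/-- A ball: a configuration `B` all of whose elements have length at most the radius. The radius
is part of the data. -/
structure ConvexBall (A : Type u) [DecidableEq A] where
  radius : ℕ
  config : ConvexConfig A
  norm_le : ∀ α ∈ config.carrier, α.norm ≤ radius

/-- `Ω^ℱ`: the configurations `ξ` such that `(α.ξ)^{r(B)} ≠ B` for all `B ∈ ℱ` and `α ∈ ξ`. -/
def forbid {A : Type u} [DecidableEq A] (F : Set (ConvexBall A)) : Set (ConvexConfig A) :=
  {ξ | ∀ B ∈ F, ∀ (α : FreeGroup A) (hα : α ∈ ξ.carrier), (ξ.shift α hα).trunc B.radius ≠ B.config}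

/-- A convex subshift over the alphabet `A`: a closed invariant subspace of the full convex
shift. -/
structure ConvexSubshift (A : Type u) where
  space : Set (ConvexConfig A)
  isClosed : IsClosed space
  isInvariant : (fullConvexShift A).IsInvariant space

namespace ConvexSubshift

/-- The partial action `𝔽(A) ↷ Ω`. -/
noncomputable def action {A : Type u} (Ω : ConvexSubshift A) : PartialAction (FreeGroup A) Ω.space :=
  (fullConvexShift A).restrictInvariant Ω.space Ω.isInvariant

/-- A convex subshift is of finite type if it is obtained by forbidding finitely many balls. -/
def IsFiniteType {A : Type u} [DecidableEq A] (Ω : ConvexSubshift A) : Prop :=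
  ∃ F : Set (ConvexBall A), F.Finite ∧ Ω.space = forbid F

end ConvexSubshift

/-! ## Separated graphs -/

/-- A separated graph with vertex set `V` and edge set `E`: `C v` is a partition of `r⁻¹(v)` into
non-empty sets. -/
structure SeparatedGraph (V : Type u) (E : Type v) where
  s : E → V
  r : E → V
  C : V → Set (Set E)
  nonempty_of_mem : ∀ v, ∀ X ∈ C v, X.Nonempty
  range_of_mem : ∀ v, ∀ X ∈ C v, ∀ e ∈ X, r e = v
  existsUnique_mem : ∀ e, ∃! X, X ∈ C (r e) ∧ e ∈ X

/-- A bipartite separated graph: the vertex set is the disjoint union of `V₀` (also written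
`E^{0,0}`) and `V₁` (`E^{0,1}`), with `s(E¹) = V₁` and `r(E¹) = V₀`. -/
structure BipartiteSeparatedGraph (V : Type u) (E : Type v) extends SeparatedGraph V E where
  V₀ : Set V
  V₁ : Set V
  isCompl : IsCompl V₀ V₁
  range_s : Set.range s = V₁
  range_r : Set.range r = V₀

/-- The local configuration of `ξ` at `α`: the letters `σ ∈ E¹ ⊔ (E¹)⁻¹` with `σ ∈ ξ · α⁻¹`;
`(e, true)` stands for `e` and `(e, false)` for `e⁻¹`. -/
def localConfig {E : Type v} (ξ : ConvexConfig E) (α : FreeGroup E) : Set (E × Bool) :=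
  {σ | FreeGroup.mk [σ] * α ∈ ξ.carrier}

namespace BipartiteSeparatedGraph

variable {V : Type u} {E : Type v}

/-- The condition on local configurations: `l = s⁻¹(v)` for some `v ∈ V₁`, or
`l = {e_X⁻¹ | X ∈ C_v}` for some `v ∈ V₀` and some choice of `e_X ∈ X`. -/
def IsAllowed (𝓔 : BipartiteSeparatedGraph V E) (l : Set (E × Bool)) : Prop :=
  (∃ v ∈ 𝓔.V₁, l = {σ | ∃ e, 𝓔.s e = v ∧ σ = (e, true)}) ∨
  (∃ v ∈ 𝓔.V₀, ∃ c : Set E → E, (∀ X ∈ 𝓔.C v, c X ∈ X) ∧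
    l = {σ | ∃ X ∈ 𝓔.C v, σ = (c X, false)})

/-- The space `Ω(E,C)`. -/
def space (𝓔 : BipartiteSeparatedGraph V E) : Set (ConvexConfig E) :=
  {ξ | ∀ α ∈ ξ.carrier, 𝓔.IsAllowed (localConfig ξ α)}

theorem isInvariant_space (𝓔 : BipartiteSeparatedGraph V E) :
    (fullConvexShift E).IsInvariant 𝓔.space := by
  intro α ξ hα hξ β hβ
  have h := hξ (β * α) hβ
  have e : localConfig ((fullConvexShift E).act α ξ hα) β = localConfig ξ (β * α) := by
    ext σ
    change FreeGroup.mk [σ] * β * α ∈ ξ.carrier ↔ FreeGroup.mk [σ] * (β * α) ∈ ξ.carrier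
    rw [mul_assoc]
  rw [e]
  exact h

/-- The canonical partial action `θ^{(E,C)}` of `𝔽(E¹)` on `Ω(E,C)`: `α` acts on `ξ` if and only
if `α ∈ ξ`, and then `α.ξ = ξ · α⁻¹`. -/
noncomputable def action (𝓔 : BipartiteSeparatedGraph V E) : PartialAction (FreeGroup E) 𝓔.space :=
  (fullConvexShift E).restrictInvariant 𝓔.space 𝓔.isInvariant_space

end BipartiteSeparatedGraph

/-! By finite type there is some `n ≥ 1` such that a configuration lies in `Ω` as soon as all
`n`-balls of its translates occur in `Ω`. A point of `Ω` is therefore encoded by local data: the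
`n`-ball at each position and, for each letter that acts there, a transition, that is, the letter
together with the balls at its two ends.

`Transition.graph` makes such data into a separated graph. Its range vertices are the occurring
balls, its source vertices the unoriented transitions `{e, e.rev}`, and each transition `e` is an
edge from its pair to its source ball. The transitions from one ball in one direction form a block
of the partition, so a configuration sitting at a ball (a node) chooses exactly one transition in
each possible direction. A configuration at a midpoint has just the edges `e` and `e.rev`. Going out
along `e⁻¹` and in along `e.rev` (`Cross`) thus simulates one letter of `A`. Standing still also
counts as a direction, with `e.rev = e`; it gives each occurring ball an edge even if no letter acts
there.

The nodes form a clopen set, which is full because one edge leads from any midpoint to a node. It is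
matched with all of `Ω`. `toConfig` collects the words that can be crossed from a node. The ball
recorded at a node is the true `n`-ball of the decoded configuration (`IsNode.trunc_toConfig`),
because every transition is realized in `Ω`; so the decoded configuration lies in `Ω`. Conversely,
`ofConfig` lets the edges act on the positions and midpoints of a point of `Ω`. That the two maps
are mutually inverse follows from `LetterSystem.config_eq`, a bisimulation principle.

The cocycle comes from one homomorphism `hom`. Each midpoint gets one of its end points as base
point, and `e` is sent to the translation from the base point to the origin of `e`; a crossing then
maps to its letter. A path between nodes consists of crossings, and a node has only one crossing per
letter. So `hom` is bijective on the elements acting between nodes from a given node, although it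
need not be injective itself. -/

open ConvexConfig

/-! ## Dynamical equivalences from group homomorphisms -/

/-- A homeomorphism that intertwines two partial actions along a group homomorphism which is, at
every point, a bijection between the group elements that act there, is part of a dynamical
equivalence. -/
theorem DynamicalEquivalence.nonempty_of_monoidHom {G : Type u} {X : Type v} {H : Type w}
    {Y : Type x} [Group G] [TopologicalSpace X] [Group H] [TopologicalSpace Y]
    (θ : PartialAction G X) (η : PartialAction H Y) (φ : X ≃ₜ Y) (Φ : G →* H)
    (h_act : ∀ g x (hx : x ∈ θ.src g), ∃ hy : φ x ∈ η.src (Φ g),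
      φ (θ.act g x hx) = η.act (Φ g) (φ x) hy)
    (h_surj : ∀ x h, φ x ∈ η.src h → ∃ g, x ∈ θ.src g ∧ Φ g = h)
    (h_inj : ∀ x g g', x ∈ θ.src g → x ∈ θ.src g' → Φ g = Φ g' → g = g') :
    Nonempty (DynamicalEquivalence θ η) := by
  have h_surj' : ∀ (h : H) (y : Y), y ∈ η.src h → ∃ g, φ.symm y ∈ θ.src g ∧ Φ g = h :=
    fun h y hy => h_surj (φ.symm y) h (by simpa using hy)
  choose b hb hΦ using h_surj'
  refine ⟨{ φ := φ, a := fun g _ _ => Φ g, b := b, a_cont := fun g => IsLocallyConstant.const _,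
            b_cont := ?_, map_act := h_act, symm_map_act := ?_, b_a := ?_, a_b := ?_,
            a_mul := fun g' g _ _ _ => map_mul Φ g' g, b_mul := ?_ }⟩
  · intro h
    rw [IsLocallyConstant.iff_exists_open]
    intro y
    -- On the open set where the value at `y` still acts, `b h` is constant: both values act at the
    -- same point and have image `h`.
    refine ⟨(fun z : η.src h => φ.symm z.1) ⁻¹' θ.src (b h y.1 y.2),
      (θ.isOpen_src _).preimage (φ.symm.continuous.comp continuous_subtype_val), hb h y.1 y.2, ?_⟩
    intro z hz
    exact h_inj _ _ _ (hb h z.1 z.2) hz ((hΦ h z.1 z.2).trans (hΦ h y.1 y.2).symm)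
  · intro h y hy
    refine ⟨hb h y hy, ?_⟩
    obtain ⟨hy', e⟩ := h_act _ _ (hb h y hy)
    rw [φ.symm_apply_eq, e]
    have : ∀ k z (hk : z ∈ η.src k) , h = k → y = z → η.act h y hy = η.act k z hk := by
      rintro k z hk rfl rfl; rfl
    exact this _ _ _ (hΦ h y hy).symm (by simp)
  · intro g x hx hy
    refine h_inj (φ.symm (φ x)) _ _ (hb _ _ hy) (by simpa using hx) (hΦ _ _ hy)
  · intro h y hy hx
    exact hΦ h y hy
  · intro h' h y hy hy'
    have h1 := hb h y hy
    obtain ⟨h2, e2⟩ := h_act _ _ h1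
    have h3 : φ.symm (η.act h y hy) = θ.act (b h y hy) (φ.symm y) h1 := by
      rw [φ.symm_apply_eq, e2]
      have : ∀ k z (hk : z ∈ η.src k) , h = k → y = z → η.act h y hy = η.act k z hk := by
        rintro k z hk rfl rfl; rfl
      exact this _ _ _ (hΦ h y hy).symm (by simp)
    have h4 := hb h' _ hy'
    rw [h3] at h4
    refine h_inj (φ.symm y) _ _ (hb _ _ _) (θ.mem_src_mul _ _ _ h1 h4) ?_
    rw [hΦ, map_mul, hΦ, hΦ]

namespace ConvexConfig

variable {A : Type u}

/-! ## Topology of the space of convex configurations -/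

/-- Each instance of right-convexity involves two coordinates only, so the image is closed in the
product. This yields compactness, by which a continuous bijection will be a homeomorphism. -/
theorem isClosedEmbedding_boolIndicator :
    Topology.IsClosedEmbedding fun ξ : ConvexConfig A => ξ.carrier.boolIndicator := by
  refine ⟨⟨⟨rfl⟩, fun ξ η h => ?_⟩, ?_⟩
  · ext α
    have : ξ.carrier.boolIndicator α = η.carrier.boolIndicator α := congrFun h α
    rw [Set.mem_iff_boolIndicator, Set.mem_iff_boolIndicator, this]
  · have e : (Set.range fun ξ : ConvexConfig A => ξ.carrier.boolIndicator) =
        {f | f 1 = true} ∩ ⋂ (L : List (A × Bool)) (M : List (A × Bool))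
          (_ : FreeGroup.IsReduced (L ++ M)),
          {f | f (FreeGroup.mk (L ++ M)) = true → f (FreeGroup.mk M) = true} := by
      ext f
      simp only [Set.mem_range, Set.mem_inter_iff, Set.mem_ofPred_eq, Set.mem_iInter]
      constructor
      · rintro ⟨ξ, rfl⟩
        refine ⟨(Set.mem_iff_boolIndicator _ _).1 ξ.one_mem, fun L M hLM h => ?_⟩
        exact (Set.mem_iff_boolIndicator _ _).1
          (ξ.convex L M hLM ((Set.mem_iff_boolIndicator _ _).2 h))
      · rintro ⟨h1, h2⟩
        refine ⟨⟨{α | f α = true}, h1, h2⟩, funext fun α => ?_⟩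
        rw [Bool.eq_iff_iff, ← Set.mem_iff_boolIndicator]
        rfl
    rw [e]
    refine IsClosed.inter (isClosed_eq (continuous_apply _) continuous_const) ?_
    refine isClosed_iInter fun L => isClosed_iInter fun M => isClosed_iInter fun _ => ?_
    have h : IsClosed ((fun f : FreeGroup A → Bool =>
        (f (FreeGroup.mk (L ++ M)), f (FreeGroup.mk M))) ⁻¹'
          {p : Bool × Bool | p.1 = true → p.2 = true}) :=
      (isClosed_discrete _).preimage ((continuous_apply _).prodMk (continuous_apply _))
    exact h

instance : CompactSpace (ConvexConfig A) := isClosedEmbedding_boolIndicator.compactSpace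

instance : T2Space (ConvexConfig A) := isClosedEmbedding_boolIndicator.isEmbedding.t2Space

/-- Sets that are determined by finitely many coordinates are clopen. -/
theorem isClopen_of_finite {S : Set (FreeGroup A)} (hS : S.Finite) {U : Set (ConvexConfig A)}
    (hU : ∀ ξ η : ConvexConfig A, (∀ α ∈ S, α ∈ ξ.carrier ↔ α ∈ η.carrier) → ξ ∈ U → η ∈ U) :
    IsClopen U := by
  have : Finite S := hS
  let f : ConvexConfig A → (S → Bool) := fun ξ α => ξ.carrier.boolIndicator α.1
  have hf : Continuous f := continuous_pi fun α => continuous_boolIndicator α.1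
  have e : U = f ⁻¹' (f '' U) := by
    refine (Set.subset_preimage_image f U).antisymm ?_
    rintro η ⟨ξ, hξ, h⟩
    refine hU ξ η (fun α hα => ?_) hξ
    have := congrFun h ⟨α, hα⟩
    simp only [f] at this
    rw [Set.mem_iff_boolIndicator, Set.mem_iff_boolIndicator, this]
  rw [e]
  exact (isClopen_discrete _).preimage hf

/-! ## Translates -/

/-- `η` is the translate `g.ξ`. -/
def MovesTo (g : FreeGroup A) (ξ η : ConvexConfig A) : Prop :=
  ∀ β, β ∈ η.carrier ↔ β * g ∈ ξ.carrier

theorem movesTo_shift (ξ : ConvexConfig A) (g : FreeGroup A) (h : g ∈ ξ.carrier) :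
    MovesTo g ξ (ξ.shift g h) := fun _ => Iff.rfl

namespace MovesTo

variable {g h : FreeGroup A} {ξ η ζ : ConvexConfig A}

theorem mem (H : MovesTo g ξ η) : g ∈ ξ.carrier := by
  simpa using (H 1).1 η.one_mem

theorem unique (H : MovesTo g ξ η) (H' : MovesTo g ξ ζ) : η = ζ := by
  ext β; exact (H β).trans (H' β).symm

theorem eq_shift (H : MovesTo g ξ η) : η = ξ.shift g H.mem := H.unique (movesTo_shift _ _ _)

theorem refl (ξ : ConvexConfig A) : MovesTo 1 ξ ξ := fun β => by rw [mul_one]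

theorem eq_of_one (H : MovesTo 1 ξ η) : η = ξ := H.unique (refl ξ)

theorem symm (H : MovesTo g ξ η) : MovesTo g⁻¹ η ξ := fun β => by
  rw [H (β * g⁻¹), inv_mul_cancel_right]

theorem trans (H : MovesTo g ξ η) (H' : MovesTo h η ζ) : MovesTo (h * g) ξ ζ := fun β => by
  rw [H' β, H (β * h), mul_assoc]

theorem unique_left (H : MovesTo g η ξ) (H' : MovesTo g ζ ξ) : η = ζ := H.symm.unique H'.symm

theorem factor (H : MovesTo g ξ η) (H' : MovesTo (h * g) ξ ζ) : MovesTo h η ζ := by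
  simpa using H.symm.trans H'

end MovesTo

theorem exists_movesTo {g : FreeGroup A} {ξ : ConvexConfig A} (h : g ∈ ξ.carrier) :
    ∃ η, MovesTo g ξ η := ⟨_, movesTo_shift ξ g h⟩

/-- The complement is open as well: it consists of the configurations on which `g` does not act, a
clopen condition, and of those moved into `Sᶜ`. -/
theorem isClopen_preimage_movesTo (g : FreeGroup A) {S : Set (ConvexConfig A)} (hS : IsClopen S) :
    IsClopen {ξ | ∃ η ∈ S, MovesTo g ξ η} := by
  have key : ∀ T : Set (ConvexConfig A), IsOpen T → IsOpen {ξ | ∃ η ∈ T, MovesTo g ξ η} := by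
    intro T hT
    have h1 := hT.preimage ((fullConvexShift A).continuous_act g)
    convert ((fullConvexShift A).isOpen_src g).isOpenMap_subtype_val _ h1 using 1
    ext ξ
    constructor
    · rintro ⟨η, hη, H⟩
      exact ⟨⟨ξ, H.mem⟩, by rw [H.eq_shift] at hη; exact hη, rfl⟩
    · rintro ⟨⟨ξ, h⟩, hξ, rfl⟩
      exact ⟨_, hξ, movesTo_shift ξ g h⟩
  refine ⟨⟨?_⟩, key S hS.isOpen⟩
  convert (isClopen_mem g).compl.isOpen.union (key Sᶜ hS.compl.isOpen) using 1
  ext ξ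
  simp only [Set.mem_compl_iff, Set.mem_ofPred_eq, Set.mem_union]
  constructor
  · intro h
    by_cases hg : g ∈ ξ.carrier
    · exact Or.inr ⟨_, fun h' => h ⟨_, h', movesTo_shift ξ g hg⟩, movesTo_shift ξ g hg⟩
    · exact Or.inl hg
  · rintro (h | ⟨η, hη, H⟩) ⟨ζ, hζ, H'⟩
    · exact h H'.mem
    · exact hη (by rwa [H.unique H'])

/-- A reduced word belongs to `ξ` if and only if its last letter moves `ξ` to a configuration that
contains the rest of the word. -/
theorem mk_append_singleton_mem {ξ : ConvexConfig A} {L : List (A × Bool)} {σ : A × Bool}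
    (hL : FreeGroup.IsReduced (L ++ [σ])) :
    FreeGroup.mk (L ++ [σ]) ∈ ξ.carrier ↔
      ∃ η, MovesTo (FreeGroup.mk [σ]) ξ η ∧ FreeGroup.mk L ∈ η.carrier := by
  constructor
  · intro h
    obtain ⟨η, H⟩ := exists_movesTo (ξ.convex L [σ] hL h)
    exact ⟨η, H, (H _).2 (by simpa [FreeGroup.mul_mk] using h)⟩
  · rintro ⟨η, H, h⟩
    simpa [FreeGroup.mul_mk] using (H _).1 h

end ConvexConfig

/-! ## Letters acting by partial bijections -/

/-- A family of partial bijections of `Z`, indexed by the letters of `𝔽(A)`, such that inverse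
letters act by inverse partial bijections. -/
structure LetterSystem (A : Type u) (Z : Type v) where
  Step : A × Bool → Z → Z → Prop
  step_unique : ∀ {σ z z₁ z₂}, Step σ z z₁ → Step σ z z₂ → z₁ = z₂
  step_symm : ∀ {a b z z'}, Step (a, b) z z' → Step (a, !b) z' z

namespace LetterSystem


variable {A : Type u} {Z : Type v} (S : LetterSystem A Z)

/-- The word `L` leads from one state to the other; its last letter acts first. -/
def Walk : List (A × Bool) → Z → Z → Prop
  | [], z, z' => z = z'
  | σ :: L, z, z' => ∃ y, Walk L z y ∧ S.Step σ y z'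

variable {S} {z z' z'' : Z}

theorem walk_append {L M : List (A × Bool)} :
    S.Walk (L ++ M) z z' ↔ ∃ y, S.Walk M z y ∧ S.Walk L y z' := by
  induction L generalizing z' with
  | nil => simp [Walk]
  | cons σ L ih =>
    simp only [List.cons_append, Walk, ih]
    constructor
    · rintro ⟨y, ⟨t, h1, h2⟩, h3⟩
      exact ⟨t, h1, y, h2, h3⟩
    · rintro ⟨t, h1, y, h2, h3⟩
      exact ⟨y, ⟨t, h1, h2⟩, h3⟩

theorem walk_singleton {σ : A × Bool} : S.Walk [σ] z z' ↔ S.Step σ z z' := by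
  simp [Walk]

theorem Walk.unique {L : List (A × Bool)} {z₁ z₂ : Z} (h : S.Walk L z z₁) (h' : S.Walk L z z₂) :
    z₁ = z₂ := by
  induction L generalizing z₁ z₂ with
  | nil => exact h.symm.trans h'
  | cons σ L ih =>
    obtain ⟨y, h1, h2⟩ := h
    obtain ⟨y', h1', h2'⟩ := h'
    obtain rfl := ih h1 h1'
    exact S.step_unique h2 h2'

/-- A letter followed by its inverse returns to the state it left, so cancelling the two keeps the
walk. Inserting such a pair may be impossible; hence `Reach` asks for some word, and `Reach.walk`
recovers a walk along the reduced one. -/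
theorem Walk.of_step {L L' : List (A × Bool)} (h : FreeGroup.Red.Step L L') (H : S.Walk L z z') :
    S.Walk L' z z' := by
  obtain ⟨⟩ := h
  rename_i L₁ L₂ a b
  obtain ⟨y, ⟨y₁, ⟨y₂, h0, h1⟩, h2⟩, h3⟩ := walk_append.1 H
  obtain rfl := S.step_unique (by simpa using S.step_symm h1) h2
  exact walk_append.2 ⟨_, h0, h3⟩

theorem Walk.of_red {L L' : List (A × Bool)} (h : FreeGroup.Red L L') (H : S.Walk L z z') :
    S.Walk L' z z' := by
  induction h with
  | refl => exact H
  | tail _ h ih => exact ih.of_step h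

theorem Walk.invRev {L : List (A × Bool)} (H : S.Walk L z z') :
    S.Walk (FreeGroup.invRev L) z' z := by
  induction L generalizing z' with
  | nil => exact Eq.symm H
  | cons σ L ih =>
    obtain ⟨y, h1, h2⟩ := H
    have e : FreeGroup.invRev (σ :: L) = FreeGroup.invRev L ++ [(σ.1, !σ.2)] := by
      simp [FreeGroup.invRev]
    rw [e]
    exact walk_append.2 ⟨y, walk_singleton.2 (S.step_symm h2), ih h1⟩

variable (S) in
/-- The element `g` acts on the state `z` and leads to `z'`. -/
def Reach (g : FreeGroup A) (z z' : Z) : Prop := ∃ L, FreeGroup.mk L = g ∧ S.Walk L z z'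

theorem Walk.reach {L : List (A × Bool)} (h : S.Walk L z z') : S.Reach (FreeGroup.mk L) z z' :=
  ⟨L, rfl, h⟩

theorem Reach.of_step {σ : A × Bool} (h : S.Step σ z z') : S.Reach (FreeGroup.mk [σ]) z z' :=
  (walk_singleton.2 h).reach

theorem Reach.refl (z : Z) : S.Reach 1 z z := ⟨[], rfl, rfl⟩

theorem Reach.trans {g h : FreeGroup A} (H : S.Reach g z z') (H' : S.Reach h z' z'') :
    S.Reach (h * g) z z'' := by
  obtain ⟨L, rfl, H⟩ := H
  obtain ⟨M, rfl, H'⟩ := H'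
  exact ⟨M ++ L, FreeGroup.mul_mk.symm, walk_append.2 ⟨_, H, H'⟩⟩

theorem Reach.symm {g : FreeGroup A} (H : S.Reach g z z') : S.Reach g⁻¹ z' z := by
  obtain ⟨L, rfl, H⟩ := H
  exact ⟨_, FreeGroup.inv_mk.symm, H.invRev⟩

theorem Reach.unique {g : FreeGroup A} {z₁ z₂ : Z} (H : S.Reach g z z₁) (H' : S.Reach g z z₂) :
    z₁ = z₂ := by
  obtain ⟨L, rfl, H⟩ := H
  obtain ⟨M, e, H'⟩ := H'
  obtain ⟨N, h1, h2⟩ := FreeGroup.Red.exact.1 e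
  exact (H.of_red h2).unique (H'.of_red h1)

theorem Reach.walk {L : List (A × Bool)} (hL : FreeGroup.IsReduced L)
    (H : S.Reach (FreeGroup.mk L) z z') : S.Walk L z z' := by
  obtain ⟨M, e, H⟩ := H
  obtain ⟨N, h1, h2⟩ := FreeGroup.Red.exact.1 e
  rw [hL.red_iff_eq] at h2
  exact H.of_red (h2 ▸ h1)

theorem reach_mk_singleton {σ : A × Bool} : S.Reach (FreeGroup.mk [σ]) z z' ↔ S.Step σ z z' :=
  ⟨fun h => walk_singleton.1 (h.walk FreeGroup.IsReduced.singleton), Reach.of_step⟩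

variable (S) in
/-- The configuration of all group elements that act on the state `z`. -/
def config (z : Z) : ConvexConfig A where
  carrier := {g | ∃ z', S.Reach g z z'}
  one_mem := ⟨z, Reach.refl z⟩
  convex L M h := by
    rintro ⟨z', H⟩
    obtain ⟨y, h1, -⟩ := walk_append.1 (H.walk h)
    exact ⟨y, h1.reach⟩

theorem mem_config {g : FreeGroup A} : g ∈ (S.config z).carrier ↔ ∃ z', S.Reach g z z' := Iff.rfl

theorem mk_mem_config {L : List (A × Bool)} (hL : FreeGroup.IsReduced L) :
    FreeGroup.mk L ∈ (S.config z).carrier ↔ ∃ z', S.Walk L z z' :=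
  ⟨fun ⟨z', h⟩ => ⟨z', h.walk hL⟩, fun ⟨z', h⟩ => ⟨z', h.reach⟩⟩

theorem mk_singleton_mem_config {σ : A × Bool} :
    FreeGroup.mk [σ] ∈ (S.config z).carrier ↔ ∃ z', S.Step σ z z' := by
  simp only [mem_config, reach_mk_singleton]

theorem Reach.movesTo {g : FreeGroup A} (H : S.Reach g z z') :
    MovesTo g (S.config z) (S.config z') := by
  intro β
  constructor
  · rintro ⟨y, h⟩
    exact ⟨y, H.trans h⟩
  · rintro ⟨y, h⟩
    exact ⟨y, by simpa using H.symm.trans h⟩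

theorem localConfig_config {g : FreeGroup A} (H : S.Reach g z z') :
    localConfig (S.config z) g = {σ | ∃ y, S.Step σ z' y} := by
  ext σ
  rw [localConfig, Set.mem_ofPred_eq, ← H.movesTo, mk_singleton_mem_config]
  rfl

/-- A configuration that admits the same letters as the state `z`, and so on after every step, is
the configuration of `z`. -/
theorem config_eq (R : Z → ConvexConfig A → Prop)
    (h_mem : ∀ z ξ σ, R z ξ → (FreeGroup.mk [σ] ∈ ξ.carrier ↔ ∃ z', S.Step σ z z'))
    (h_step : ∀ z ξ σ z' ξ', R z ξ → S.Step σ z z' → MovesTo (FreeGroup.mk [σ]) ξ ξ' → R z' ξ')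
    {ξ : ConvexConfig A} (h : R z ξ) : S.config z = ξ := by
  have key : ∀ L : List (A × Bool), FreeGroup.IsReduced L → ∀ z ξ, R z ξ →
      ((∃ z', S.Walk L z z') ↔ FreeGroup.mk L ∈ ξ.carrier) := by
    intro L
    induction L using List.reverseRecOn with
    | nil =>
      intro _ z ξ _
      exact ⟨fun _ => ξ.one_mem, fun _ => ⟨z, rfl⟩⟩
    | append_singleton L σ ih =>
      intro hL z ξ hR
      have hL' : FreeGroup.IsReduced L := hL.infix ⟨[], [σ], by simp⟩
      rw [mk_append_singleton_mem hL]
      simp only [walk_append, walk_singleton]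
      constructor
      · rintro ⟨z', y, h1, h2⟩
        obtain ⟨η, H⟩ := exists_movesTo ((h_mem z ξ σ hR).2 ⟨y, h1⟩)
        exact ⟨η, H, (ih hL' y η (h_step _ _ _ _ _ hR h1 H)).1 ⟨z', h2⟩⟩
      · rintro ⟨η, H, h2⟩
        obtain ⟨y, h1⟩ := (h_mem z ξ σ hR).1 H.mem
        obtain ⟨z', h3⟩ := (ih hL' y η (h_step _ _ _ _ _ hR h1 H)).2 h2
        exact ⟨z', y, h1, h3⟩
  classical
  ext g
  rw [← FreeGroup.mk_toWord (x := g), mk_mem_config FreeGroup.isReduced_toWord]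
  exact key _ FreeGroup.isReduced_toWord z ξ h

end LetterSystem

/-! ## Directions -/

/-- A direction is a letter or `none`, which stands for standing still. -/
abbrev Dir (A : Type u) := Option (A × Bool)

namespace Dir

variable {A : Type u}

/-- The group element of a direction. -/
def elt : Dir A → FreeGroup A
  | none => 1
  | some σ => FreeGroup.mk [σ]

/-- The opposite direction. -/
def rev : Dir A → Dir A
  | none => none
  | some (a, b) => some (a, !b)

/-- The translation from the origin of a direction to the base point of its unoriented edge. -/
def half : Dir A → FreeGroup A
  | some (a, true) => FreeGroup.of a
  | _ => 1

/-- The letter of a direction, without its sign. -/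
def kind : Dir A → Option A
  | none => none
  | some (a, _) => some a

theorem rev_rev (o : Dir A) : o.rev.rev = o := by
  rcases o with _ | ⟨a, b⟩ <;> simp [rev]

theorem kind_rev (o : Dir A) : o.rev.kind = o.kind := by
  rcases o with _ | ⟨a, b⟩ <;> rfl

theorem rev_eq_self {o : Dir A} : o.rev = o ↔ o = none := by
  rcases o with _ | ⟨a, b⟩ <;> simp [rev]

/-- A step goes from its origin to the base point of its edge, and from there to the other end. -/
theorem elt_eq (o : Dir A) : o.elt = (half o.rev)⁻¹ * half o := by
  rcases o with _ | ⟨a, _ | _⟩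
  · simp [elt, rev, half]
  · simp [elt, rev, half, FreeGroup.of, FreeGroup.inv_mk, FreeGroup.invRev]
  · simp [elt, rev, half, FreeGroup.of]

theorem elt_rev (o : Dir A) : o.rev.elt = o.elt⁻¹ := by
  rw [elt_eq, elt_eq o, rev_rev, mul_inv_rev, inv_inv]

theorem eq_or_eq_rev_of_kind_eq {o o' : Dir A} (h : o.kind = o'.kind) : o' = o ∨ o' = o.rev := by
  rcases o with _ | ⟨a, b⟩ <;> rcases o' with _ | ⟨a', b'⟩ <;> simp_all [kind, rev]
  cases b <;> cases b' <;> simp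

theorem half_mem {o : Dir A} {ξ : ConvexConfig A} (h : o.elt ∈ ξ.carrier) :
    half o ∈ ξ.carrier := by
  rcases o with _ | ⟨a, _ | _⟩
  · exact ξ.one_mem
  · exact ξ.one_mem
  · exact h

end Dir

/-! ## Balls -/

namespace ConvexConfig

variable {A : Type u} [DecidableEq A]

theorem mem_trunc {ξ : ConvexConfig A} {n : ℕ} {α : FreeGroup A} :
    α ∈ (ξ.trunc n).carrier ↔ α ∈ ξ.carrier ∧ α.norm ≤ n := Iff.rfl

theorem norm_elt_le (o : Dir A) : o.elt.norm ≤ 1 := by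
  rcases o with _ | σ
  · simp [Dir.elt]
  · simp [Dir.elt, FreeGroup.norm]

theorem finite_norm_le [Finite A] (n : ℕ) : {α : FreeGroup A | α.norm ≤ n}.Finite :=
  Set.Finite.of_finite_image ((List.finite_length_le (A × Bool) n).subset (by
    rintro _ ⟨α, hα, rfl⟩
    exact hα)) FreeGroup.toWord_injective.injOn

theorem trunc_trunc (ξ : ConvexConfig A) {m n : ℕ} (h : m ≤ n) :
    (ξ.trunc n).trunc m = ξ.trunc m := by
  ext α
  exact ⟨fun ⟨⟨h1, _⟩, h3⟩ => ⟨h1, h3⟩, fun ⟨h1, h3⟩ => ⟨⟨h1, h3.trans h⟩, h3⟩⟩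

/-- The possible `n`-balls. -/
def IsBall (n : ℕ) (B : ConvexConfig A) : Prop := ∀ α ∈ B.carrier, α.norm ≤ n

theorem isBall_trunc (ξ : ConvexConfig A) (n : ℕ) : (ξ.trunc n).IsBall n := fun _ h => h.2

instance finite_isBall [Finite A] (n : ℕ) : Finite {B : ConvexConfig A // B.IsBall n} := by
  have := (finite_norm_le (A := A) n).finite_subsets
  have : Finite {S : Set (FreeGroup A) | S ⊆ {α | α.norm ≤ n}} := this
  refine Finite.of_injective
    (fun B => (⟨B.1.carrier, B.2⟩ : {S : Set (FreeGroup A) | S ⊆ {α | α.norm ≤ n}})) ?_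
  intro B B' h
  exact Subtype.ext (ConvexConfig.ext (congrArg Subtype.val h))

end ConvexConfig

/-! ## Transitions of a convex subshift -/

/-- A step in a configuration of `Ω`, recorded by its direction and by the `n`-balls around its
two end points. -/
@[ext] structure Transition {A : Type u} [DecidableEq A] (Ω : ConvexSubshift A) (n : ℕ) where
  dir : Dir A
  src : ConvexConfig A
  tgt : ConvexConfig A
  realized : ∃ ζ ∈ Ω.space, ∃ ζ', MovesTo dir.elt ζ ζ' ∧ ζ.trunc n = src ∧ ζ'.trunc n = tgt

namespace ConvexSubshift

variable {A : Type u} (Ω : ConvexSubshift A)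

theorem mem_of_movesTo {g : FreeGroup A} {ζ ζ' : ConvexConfig A} (h : ζ ∈ Ω.space)
    (H : MovesTo g ζ ζ') : ζ' ∈ Ω.space := by
  rw [H.eq_shift]
  exact Ω.isInvariant g ζ H.mem h

/-- A subshift of finite type is determined by the balls of some sufficiently large radius that
occur in it. -/
theorem IsFiniteType.exists_radius [DecidableEq A] {Ω : ConvexSubshift A} (hΩ : Ω.IsFiniteType) :
    ∃ n, 1 ≤ n ∧ ∀ ξ : ConvexConfig A,
      (∀ α η, MovesTo α ξ η → ∃ ζ ∈ Ω.space, η.trunc n = ζ.trunc n) → ξ ∈ Ω.space := by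
  obtain ⟨F, hF, e⟩ := hΩ
  obtain ⟨N, hN⟩ := (hF.image ConvexBall.radius).bddAbove
  -- `N` bounds the radii of the forbidden balls; adding one makes the radius positive, so that a
  -- ball shows which letters act at its centre.
  refine ⟨N + 1, by omega, fun ξ h => ?_⟩
  rw [e]
  intro B hB α hα hB'
  obtain ⟨ζ, hζ, h1⟩ := h α _ (movesTo_shift ξ α hα)
  have hr : B.radius ≤ N + 1 := (hN ⟨B, hB, rfl⟩).trans (by omega)
  rw [← trunc_trunc _ hr, h1, trunc_trunc _ hr] at hB'
  rw [e] at hζ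
  refine hζ B hB 1 ζ.one_mem ?_
  rwa [← (movesTo_shift ζ 1 ζ.one_mem).eq_of_one.symm]

end ConvexSubshift

namespace Transition

variable {A : Type u} [DecidableEq A] {Ω : ConvexSubshift A} {n : ℕ}

instance [Finite A] : Finite (Transition Ω n) := by
  refine Finite.of_injective (fun e : Transition Ω n =>
    ((e.dir, ⟨e.src, ?_⟩, ⟨e.tgt, ?_⟩) :
      Dir A × {B : ConvexConfig A // B.IsBall n} × {B : ConvexConfig A // B.IsBall n})) ?_
  · obtain ⟨ζ, _, ζ', _, h, _⟩ := e.realized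
    rw [← h]; exact isBall_trunc ζ n
  · obtain ⟨ζ, _, ζ', _, _, h⟩ := e.realized
    rw [← h]; exact isBall_trunc ζ' n
  · intro e e' h
    simp only [Prod.mk.injEq, Subtype.mk.injEq] at h
    exact Transition.ext h.1 h.2.1 h.2.2

/-- The transition in the opposite direction. -/
def rev (e : Transition Ω n) : Transition Ω n where
  dir := e.dir.rev
  src := e.tgt
  tgt := e.src
  realized := by
    obtain ⟨ζ, hζ, ζ', H, h, h'⟩ := e.realized
    refine ⟨ζ', Ω.mem_of_movesTo hζ H, ζ, ?_, h', h⟩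
    rw [Dir.elt_rev]
    exact H.symm

@[simp] theorem dir_rev (e : Transition Ω n) : e.rev.dir = e.dir.rev := rfl
@[simp] theorem src_rev (e : Transition Ω n) : e.rev.src = e.tgt := rfl

@[simp] theorem rev_rev (e : Transition Ω n) : e.rev.rev = e :=
  Transition.ext (Dir.rev_rev _) rfl rfl

theorem tgt_eq_src (e : Transition Ω n) (h : e.dir = none) : e.tgt = e.src := by
  obtain ⟨ζ, hζ, ζ', H, h1, h2⟩ := e.realized
  rw [h] at H
  rw [← h1, ← h2, H.eq_of_one]

/-- Standing still is the only case in which the two edges at a midpoint coincide. -/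
theorem rev_eq_self {e : Transition Ω n} : e.rev = e ↔ e.dir = none := by
  constructor
  · intro h
    exact Dir.rev_eq_self.1 (congrArg Transition.dir h)
  · intro h
    exact Transition.ext (by simp [h, Dir.rev]) (e.tgt_eq_src h) (e.tgt_eq_src h).symm

/-- The step from `ζ` in the direction of `e` is possible and is of the form `e`. -/
def IsLabel (ζ : ConvexConfig A) (e : Transition Ω n) : Prop :=
  ζ ∈ Ω.space ∧ ζ.trunc n = e.src ∧ ∃ ζ', MovesTo e.dir.elt ζ ζ' ∧ ζ'.trunc n = e.tgt

theorem IsLabel.eq {ζ : ConvexConfig A} {e f : Transition Ω n} (he : IsLabel ζ e)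
    (hf : IsLabel ζ f) (h : e.dir = f.dir) : e = f := by
  obtain ⟨_, h1, ζ', H, h2⟩ := he
  obtain ⟨_, h1', ζ'', H', h2'⟩ := hf
  rw [h] at H
  obtain rfl := H.unique H'
  exact Transition.ext h (h1.symm.trans h1') (h2.symm.trans h2')

theorem exists_isLabel {ζ ζ' : ConvexConfig A} {o : Dir A} (hζ : ζ ∈ Ω.space)
    (H : MovesTo o.elt ζ ζ') : ∃ e : Transition Ω n, e.dir = o ∧ IsLabel ζ e :=
  ⟨⟨o, ζ.trunc n, ζ'.trunc n, ζ, hζ, ζ', H, rfl, rfl⟩, rfl, hζ, rfl, ζ', H, rfl⟩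

theorem IsLabel.rev {ζ ζ' : ConvexConfig A} {e : Transition Ω n} (he : IsLabel ζ e)
    (H : MovesTo e.dir.elt ζ ζ') : IsLabel ζ' e.rev := by
  obtain ⟨hζ, h1, ζ'', H', h2⟩ := he
  obtain rfl := H.unique H'
  refine ⟨Ω.mem_of_movesTo hζ H, h2, ζ, ?_, h1⟩
  rw [dir_rev, Dir.elt_rev]
  exact H.symm

/-- Balls of radius at least one know the possible directions. -/
theorem exists_dir_eq_iff (hn : 1 ≤ n) (e : Transition Ω n) (o : Dir A) :
    (∃ f : Transition Ω n, f.src = e.src ∧ f.dir = o) ↔ o.elt ∈ e.src.carrier := by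
  constructor
  · rintro ⟨f, h, rfl⟩
    obtain ⟨ζ, hζ, ζ', H, h1, h2⟩ := f.realized
    rw [← h, ← h1]
    exact ⟨H.mem, (norm_elt_le _).trans hn⟩
  · intro h
    obtain ⟨ζ, hζ, ζ', H, h1, h2⟩ := e.realized
    rw [← h1] at h
    obtain ⟨ζ'', H'⟩ := exists_movesTo h.1
    exact ⟨⟨o, ζ.trunc n, ζ''.trunc n, ζ, hζ, ζ'', H', rfl, rfl⟩, h1, rfl⟩

/-! ## The separated graph of a convex subshift -/

/-- The vertices: the occurring `n`-balls and the unoriented transitions. -/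
abbrev Vertex (Ω : ConvexSubshift A) (n : ℕ) : Type u :=
  {B : ConvexConfig A // ∃ e : Transition Ω n, e.src = B} ⊕
    Set.range fun e : Transition Ω n => ({e, e.rev} : Set (Transition Ω n))

instance [Finite A] : Finite (Vertex Ω n) := by
  have : Finite {B : ConvexConfig A // ∃ e : Transition Ω n, e.src = B} :=
    Finite.of_surjective (fun e : Transition Ω n =>
      (⟨e.src, e, rfl⟩ : {B : ConvexConfig A // ∃ e : Transition Ω n, e.src = B}))
      (by rintro ⟨_, e, rfl⟩; exact ⟨e, rfl⟩)
  infer_instance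

/-- The unoriented transition of `e`. -/
def pair (e : Transition Ω n) :
    Set.range fun e : Transition Ω n => ({e, e.rev} : Set (Transition Ω n)) := ⟨_, e, rfl⟩

/-- The origin of `e` as a vertex. -/
def base (e : Transition Ω n) : {B : ConvexConfig A // ∃ e : Transition Ω n, e.src = B} :=
  ⟨e.src, e, rfl⟩

theorem base_eq_iff {e f : Transition Ω n} : base f = base e ↔ f.src = e.src := Subtype.mk_eq_mk

theorem pair_eq_iff {e f : Transition Ω n} : pair f = pair e ↔ f = e ∨ f = e.rev := by
  refine Subtype.mk_eq_mk.trans ?_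
  constructor
  · intro h
    have : f ∈ ({e, e.rev} : Set (Transition Ω n)) := by
      rw [← show ({f, f.rev} : Set _) = {e, e.rev} from h]; simp
    simpa using this
  · rintro (rfl | rfl)
    · rfl
    · simp [Set.pair_comm]

/-- The transitions with the origin and direction of `e`. -/
def parallel (e : Transition Ω n) : Set (Transition Ω n) :=
  {f | f.src = e.src ∧ f.dir = e.dir}

theorem parallel_congr {e f : Transition Ω n} (h : f ∈ parallel e) : parallel f = parallel e := by
  ext t
  simp only [parallel, Set.mem_ofPred_eq, h.1, h.2]

variable (Ω n) in
/-- The bipartite separated graph of a convex subshift: its edges are the transitions; they lead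
from the unoriented transitions to the balls, and are separated according to their directions. -/
def graph : BipartiteSeparatedGraph (Vertex Ω n) (Transition Ω n) where
  s e := Sum.inr e.pair
  r e := Sum.inl e.base
  C v := {X | ∃ e : Transition Ω n, v = Sum.inl e.base ∧ X = e.parallel}
  nonempty_of_mem := by
    rintro _ _ ⟨e, rfl, rfl⟩
    exact ⟨e, rfl, rfl⟩
  range_of_mem := by
    rintro _ _ ⟨e, rfl, rfl⟩ f hf
    exact congrArg Sum.inl (base_eq_iff.2 hf.1)
  existsUnique_mem e := by
    refine ⟨e.parallel, ⟨⟨e, rfl, rfl⟩, rfl, rfl⟩, ?_⟩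
    rintro _ ⟨⟨f, -, rfl⟩, h⟩
    exact (parallel_congr h).symm
  V₀ := Set.range Sum.inl
  V₁ := Set.range Sum.inr
  isCompl := Set.isCompl_range_inl_range_inr
  range_s := by
    ext v
    constructor
    · rintro ⟨e, rfl⟩; exact ⟨_, rfl⟩
    · rintro ⟨⟨_, e, rfl⟩, rfl⟩; exact ⟨e, rfl⟩
  range_r := by
    ext v
    constructor
    · rintro ⟨e, rfl⟩; exact ⟨_, rfl⟩
    · rintro ⟨⟨_, e, rfl⟩, rfl⟩; exact ⟨e, rfl⟩

theorem isAllowed_pair (e : Transition Ω n) :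
    (graph Ω n).IsAllowed {(e, true), (e.rev, true)} := by
  refine Or.inl ⟨Sum.inr e.pair, ⟨_, rfl⟩, ?_⟩
  ext ⟨f, b⟩
  simp only [graph, Set.mem_insert_iff, Set.mem_singleton_iff, Prod.mk.injEq, Set.mem_ofPred_eq,
    Sum.inr.injEq, pair_eq_iff]
  aesop

/-- The local configurations at balls. -/
structure IsStar (l : Set (Transition Ω n × Bool)) (e : Transition Ω n) : Prop where
  not_mem : ∀ f, (f, true) ∉ l
  src_eq : ∀ f, (f, false) ∈ l → f.src = e.src
  unique : ∀ f f', (f, false) ∈ l → (f', false) ∈ l → f.dir = f'.dir → f = f'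
  complete : ∀ f : Transition Ω n, f.src = e.src → ∃ f', (f', false) ∈ l ∧ f'.dir = f.dir

/-- Choosing one edge from each block at a ball amounts to choosing one transition in each direction
possible there; `IsStar` says this without a choice function. -/
theorem isAllowed_iff {l : Set (Transition Ω n × Bool)} :
    (graph Ω n).IsAllowed l ↔ (∃ e, l = {(e, true), (e.rev, true)}) ∨ ∃ e, IsStar l e := by
  constructor
  · rintro (⟨_, ⟨⟨_, e, rfl⟩, rfl⟩, rfl⟩ | ⟨_, ⟨⟨_, e, rfl⟩, rfl⟩, c, hc, rfl⟩)
    · left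
      refine ⟨e, ?_⟩
      ext ⟨f, b⟩
      constructor
      · rintro ⟨t, h, heq⟩
        obtain ⟨rfl, rfl⟩ := Prod.mk.inj heq
        have := pair_eq_iff.1 (Sum.inr_injective h)
        simpa using this
      · intro h
        have h : (f = e ∨ f = e.rev) ∧ b = true := by
          simp only [Set.mem_insert_iff, Set.mem_singleton_iff, Prod.mk.injEq] at h
          tauto
        exact ⟨f, congrArg Sum.inr (pair_eq_iff.2 h.1), congrArg (f, ·) h.2⟩
    · right
      have hc' : ∀ f : Transition Ω n, f.src = e.src → c f.parallel ∈ f.parallel := fun f hf =>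
        hc _ ⟨f, congrArg Sum.inl (base_eq_iff (e := f) (f := e)|>.2 hf.symm), rfl⟩
      have hX : ∀ X ∈ (graph Ω n).C (Sum.inl ⟨e.src, e, rfl⟩), ∃ f : Transition Ω n,
          f.src = e.src ∧ X = f.parallel := by
        rintro X ⟨f, h, rfl⟩
        exact ⟨f, (base_eq_iff (e := f) (f := e)|>.1 (Sum.inl_injective h)).symm, rfl⟩
      refine ⟨e, ⟨?_, ?_, ?_, ?_⟩⟩
      · rintro f ⟨X, hX, h⟩
        simp at h
      · rintro f ⟨X, hX', h⟩
        obtain ⟨t, ht, rfl⟩ := hX X hX'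
        obtain rfl : f = c t.parallel := (Prod.mk.inj h).1
        exact (hc' t ht).1.trans ht
      · rintro f f' ⟨X, hX1, h1⟩ ⟨X', hX2, h2⟩ h
        obtain ⟨t, ht, rfl⟩ := hX X hX1
        obtain ⟨t', ht', rfl⟩ := hX X' hX2
        obtain rfl : f = c t.parallel := (Prod.mk.inj h1).1
        obtain rfl : f' = c t'.parallel := (Prod.mk.inj h2).1
        have : t.parallel = t'.parallel := parallel_congr
          ⟨ht.trans ht'.symm, (hc' t ht).2.symm.trans (h.trans (hc' t' ht').2)⟩
        rw [this]
      · intro f hf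
        exact ⟨c f.parallel, ⟨f.parallel,
          ⟨f, congrArg Sum.inl (base_eq_iff (e := f) (f := e)|>.2 hf.symm), rfl⟩, rfl⟩,
          (hc' f hf).2⟩
  · rintro (⟨e, rfl⟩ | ⟨e, h⟩)
    · exact isAllowed_pair e
    · have key : ∀ X : Set (Transition Ω n), ∃ f : Transition Ω n,
          X ∈ (graph Ω n).C (Sum.inl e.base) → f ∈ X ∧ (f, false) ∈ l := by
        intro X
        by_cases hX : X ∈ (graph Ω n).C (Sum.inl e.base)
        · obtain ⟨f, h1, rfl⟩ := hX
          have h1 := base_eq_iff.1 (Sum.inl_injective h1)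
          obtain ⟨f', h2, h3⟩ := h.complete f h1.symm
          exact ⟨f', fun _ => ⟨⟨(h.src_eq f' h2).trans h1, h3⟩, h2⟩⟩
        -- A default value: the choice function must be defined on all sets, but only the blocks at
        -- the ball matter.
        · exact ⟨e, fun h => absurd h hX⟩
      choose c hc using key
      refine Or.inr ⟨Sum.inl e.base, ⟨_, rfl⟩, c, fun X hX => (hc X hX).1, ?_⟩
      ext ⟨f, b⟩
      constructor
      · intro hf
        cases b with
        | true => exact absurd hf (h.not_mem f)
        | false =>
          have hX : f.parallel ∈ (graph Ω n).C (Sum.inl e.base) :=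
            ⟨f, congrArg Sum.inl (base_eq_iff.2 (h.src_eq f hf).symm), rfl⟩
          obtain ⟨h1, h2⟩ := hc _ hX
          exact ⟨f.parallel, hX, congrArg (·, false) (h.unique _ _ hf h2 h1.2.symm)⟩
      · rintro ⟨X, hX, h1⟩
        rw [h1]
        exact (hc X hX).2

end Transition

namespace Transition

variable {A : Type u} [DecidableEq A] {Ω : ConvexSubshift A} {n : ℕ}

/-! ## Configurations of the separated graph -/

theorem mk_true (e : Transition Ω n) : FreeGroup.mk [(e, true)] = FreeGroup.of e := rfl

theorem mk_false (e : Transition Ω n) : FreeGroup.mk [(e, false)] = (FreeGroup.of e)⁻¹ := rfl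

theorem mem_localConfig_one {x : ConvexConfig (Transition Ω n)} {σ : Transition Ω n × Bool} :
    σ ∈ localConfig x 1 ↔ FreeGroup.mk [σ] ∈ x.carrier := by
  rw [localConfig, Set.mem_ofPred_eq, mul_one]

theorem mem_space_of_movesTo {x y : ConvexConfig (Transition Ω n)} {g : FreeGroup (Transition Ω n)}
    (hx : x ∈ (graph Ω n).space) (H : MovesTo g x y) : y ∈ (graph Ω n).space := by
  rw [H.eq_shift]
  exact (graph Ω n).isInvariant_space g x H.mem hx

theorem isAllowed_one {x : ConvexConfig (Transition Ω n)} (hx : x ∈ (graph Ω n).space) :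
    (graph Ω n).IsAllowed (localConfig x 1) := hx 1 x.one_mem

/-- The configurations of the separated graph that sit at a ball. -/
def IsNode (x : ConvexConfig (Transition Ω n)) : Prop :=
  x ∈ (graph Ω n).space ∧ ∃ e, (FreeGroup.of e)⁻¹ ∈ x.carrier

/-- An inverse edge rules out the midpoint case, and all edges of a star have the same source, so
any of them can name the ball. -/
theorem IsNode.isStar {x : ConvexConfig (Transition Ω n)} (hx : IsNode x) {e : Transition Ω n}
    (he : (FreeGroup.of e)⁻¹ ∈ x.carrier) : IsStar (localConfig x 1) e := by
  have he' : (e, false) ∈ localConfig x 1 := mem_localConfig_one.2 he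
  rcases isAllowed_iff.1 (isAllowed_one hx.1) with ⟨f, h⟩ | ⟨f, h⟩
  · rw [h] at he'
    simp at he'
  · have := h.src_eq e he'
    exact ⟨h.not_mem, fun t ht => (h.src_eq t ht).trans this.symm, h.unique,
      fun t ht => h.complete t (ht.trans this)⟩

theorem IsNode.of_not_mem {x : ConvexConfig (Transition Ω n)} (hx : IsNode x) (e : Transition Ω n) :
    FreeGroup.of e ∉ x.carrier := by
  obtain ⟨f, hf⟩ := hx.2
  exact fun h => (hx.isStar hf).not_mem e (mem_localConfig_one.2 h)

theorem localConfig_of_mem {x : ConvexConfig (Transition Ω n)} (hx : x ∈ (graph Ω n).space)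
    {e : Transition Ω n} (he : FreeGroup.of e ∈ x.carrier) :
    localConfig x 1 = {(e, true), (e.rev, true)} := by
  have he' : (e, true) ∈ localConfig x 1 := mem_localConfig_one.2 he
  rcases isAllowed_iff.1 (isAllowed_one hx) with ⟨f, h⟩ | ⟨f, h⟩
  · rw [h] at he' ⊢
    have : e = f ∨ e = f.rev := by simpa using he'
    rcases this with rfl | rfl
    · rfl
    · rw [rev_rev, Set.pair_comm]
  · exact absurd he' (h.not_mem e)

theorem of_mem_iff {x : ConvexConfig (Transition Ω n)} (hx : x ∈ (graph Ω n).space)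
    {e : Transition Ω n} (he : FreeGroup.of e ∈ x.carrier) (f : Transition Ω n) :
    FreeGroup.of f ∈ x.carrier ↔ f = e ∨ f = e.rev := by
  rw [← mk_true, ← mem_localConfig_one, localConfig_of_mem hx he]
  simp

theorem not_inv_of_mem {x : ConvexConfig (Transition Ω n)} (hx : x ∈ (graph Ω n).space)
    {e : Transition Ω n} (he : FreeGroup.of e ∈ x.carrier) (f : Transition Ω n) :
    (FreeGroup.of f)⁻¹ ∉ x.carrier :=
  fun h => IsNode.of_not_mem ⟨hx, f, h⟩ e he

theorem exists_of_mem_of_not_isNode {x : ConvexConfig (Transition Ω n)}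
    (hx : x ∈ (graph Ω n).space) (h : ¬ IsNode x) : ∃ e, FreeGroup.of e ∈ x.carrier := by
  rcases isAllowed_iff.1 (isAllowed_one hx) with ⟨f, hf⟩ | ⟨f, hf⟩
  · exact ⟨f, by rw [← mk_true, ← mem_localConfig_one, hf]; simp⟩
  · obtain ⟨f', h1, -⟩ := hf.complete f rfl
    exact absurd ⟨hx, f', mem_localConfig_one.1 h1⟩ h

/-- The configuration `x'` is reached from `x` by traversing `e`. -/
def Cross (e : Transition Ω n) (x x' : ConvexConfig (Transition Ω n)) : Prop :=
  ∃ y, MovesTo (FreeGroup.of e)⁻¹ x y ∧ MovesTo (FreeGroup.of e.rev) y x'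

namespace Cross

variable {e : Transition Ω n} {x x' x'' : ConvexConfig (Transition Ω n)}

theorem symm (h : Cross e x x') : Cross e.rev x' x := by
  obtain ⟨y, h1, h2⟩ := h
  exact ⟨y, h2.symm, by simpa using h1.symm⟩

theorem movesTo (h : Cross e x x') :
    MovesTo (FreeGroup.of e.rev * (FreeGroup.of e)⁻¹) x x' := by
  obtain ⟨y, h1, h2⟩ := h
  exact h1.trans h2

theorem mem (h : Cross e x x') : (FreeGroup.of e)⁻¹ ∈ x.carrier := by
  obtain ⟨y, h1, h2⟩ := h
  exact h1.mem

theorem unique (h : Cross e x x') (h' : Cross e x x'') : x' = x'' := h.movesTo.unique h'.movesTo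

theorem isNode (h : Cross e x x') (hx : IsNode x) : IsNode x' :=
  ⟨mem_space_of_movesTo hx.1 h.movesTo, _, h.symm.mem⟩

end Cross

/-- At the midpoint the edge `e` leads back, so the local configuration there is `{e, e.rev}` and
`e.rev` is available too. -/
theorem IsNode.exists_cross {x : ConvexConfig (Transition Ω n)} (hx : IsNode x)
    {e : Transition Ω n} (he : (FreeGroup.of e)⁻¹ ∈ x.carrier) : ∃ x', Cross e x x' := by
  obtain ⟨y, hy⟩ := exists_movesTo he
  have h := (of_mem_iff (mem_space_of_movesTo hx.1 hy)
    (by simpa using hy.symm.mem) e.rev).2 (Or.inr rfl)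
  obtain ⟨x', hx'⟩ := exists_movesTo h
  exact ⟨x', y, hy, hx'⟩

/-! ## From the separated graph to the convex subshift -/

variable (Ω n) in
/-- The letters of the subshift act on the configurations at balls, together with the elements of
the free group on the transitions that implement this action. -/
def nodeSystem : LetterSystem A (ConvexConfig (Transition Ω n) × FreeGroup (Transition Ω n)) where
  Step σ z z' := IsNode z.1 ∧ ∃ e : Transition Ω n, e.dir = some σ ∧ Cross e z.1 z'.1 ∧
    z'.2 = FreeGroup.of e.rev * (FreeGroup.of e)⁻¹ * z.2
  step_unique := by
    rintro σ ⟨x, g⟩ ⟨x₁, g₁⟩ ⟨x₂, g₂⟩ ⟨hx, e, h1, h2, h3⟩ ⟨-, f, h1', h2', h3'⟩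
    -- A node has at most one transition in each direction.
    obtain rfl : e = f := (hx.isStar h2.mem).unique e f (mem_localConfig_one.2 h2.mem)
      (mem_localConfig_one.2 h2'.mem) (h1.trans h1'.symm)
    exact Prod.ext (h2.unique h2') (h3.trans h3'.symm)
  step_symm := by
    rintro a b ⟨x, g⟩ ⟨x', g'⟩ ⟨hx, e, h1, h2, h3⟩
    refine ⟨h2.isNode hx, e.rev, by simp [h1, Dir.rev], h2.symm, ?_⟩
    simp only at h3
    simp [h3, mul_assoc]

/-- The configuration of `𝒞(A)` that is described by a configuration of the separated graph. -/
def toConfig (x : ConvexConfig (Transition Ω n)) : ConvexConfig A := (nodeSystem Ω n).config (x, 1)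

/-- The group component merely records the path; whether a letter acts depends on the node alone. -/
theorem config_nodeSystem (x : ConvexConfig (Transition Ω n)) (g : FreeGroup (Transition Ω n)) :
    (nodeSystem Ω n).config (x, g) = toConfig x := by
  have h_step : ∀ {σ z z'} (g : FreeGroup (Transition Ω n)), (nodeSystem Ω n).Step σ z z' →
      ∃ g', (nodeSystem Ω n).Step σ (z.1, g) (z'.1, g') := by
    rintro σ z z' g ⟨hz, e, h1, h2, -⟩
    exact ⟨FreeGroup.of e.rev * (FreeGroup.of e)⁻¹ * g, hz, e, h1, h2, rfl⟩
  refine LetterSystem.config_eq (fun z ξ => ∃ g, ξ = (nodeSystem Ω n).config (z.1, g))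
    ?_ ?_ ⟨1, rfl⟩
  · rintro ⟨x, g⟩ _ σ ⟨g', rfl⟩
    rw [LetterSystem.mk_singleton_mem_config]
    constructor
    · rintro ⟨z', h⟩
      obtain ⟨g'', h'⟩ := h_step g h
      exact ⟨_, h'⟩
    · rintro ⟨z', h⟩
      obtain ⟨g'', h'⟩ := h_step g' h
      exact ⟨_, h'⟩
  · rintro ⟨x, g⟩ _ σ ⟨x', t⟩ ξ' ⟨g', rfl⟩ h H
    obtain ⟨g'', h'⟩ := h_step g' h
    exact ⟨g'', H.unique (LetterSystem.Reach.of_step h').movesTo⟩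

theorem Cross.movesTo_toConfig {x x' : ConvexConfig (Transition Ω n)} {e : Transition Ω n}
    (hx : IsNode x) (h : Cross e x x') {σ : A × Bool} (he : e.dir = some σ) :
    MovesTo (FreeGroup.mk [σ]) (toConfig x) (toConfig x') := by
  have h1 : (nodeSystem Ω n).Step σ (x, 1) (x', FreeGroup.of e.rev * (FreeGroup.of e)⁻¹ * 1) :=
    ⟨hx, e, he, h, rfl⟩
  have h2 := (LetterSystem.Reach.of_step h1).movesTo
  rwa [config_nodeSystem, config_nodeSystem] at h2

theorem mk_singleton_mem_toConfig {x : ConvexConfig (Transition Ω n)} (hx : IsNode x)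
    {σ : A × Bool} : FreeGroup.mk [σ] ∈ (toConfig x).carrier ↔
      ∃ e : Transition Ω n, e.dir = some σ ∧ ∃ x', Cross e x x' := by
  rw [toConfig, LetterSystem.mk_singleton_mem_config]
  constructor
  · rintro ⟨⟨x', g⟩, -, e, h1, h2, -⟩
    exact ⟨e, h1, x', h2⟩
  · rintro ⟨e, h1, x', h2⟩
    exact ⟨⟨x', _⟩, hx, e, h1, h2, rfl⟩

/-- Induction on the word, whose last letter acts first. That letter crosses some `f`, and the
shorter word is tested at the far node, in the ball `f.tgt`. Since `f` is realized by two
neighbouring points of `Ω`, its two balls agree about the word. -/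
theorem IsNode.mk_mem_toConfig_iff (hn : 1 ≤ n) {L : List (A × Bool)} (hL : FreeGroup.IsReduced L)
    (hLn : L.length ≤ n) {x : ConvexConfig (Transition Ω n)} (hx : IsNode x) {e : Transition Ω n}
    (he : (FreeGroup.of e)⁻¹ ∈ x.carrier) :
    FreeGroup.mk L ∈ (toConfig x).carrier ↔ FreeGroup.mk L ∈ e.src.carrier := by
  induction L using List.reverseRecOn generalizing x e with
  | nil => exact ⟨fun _ => e.src.one_mem, fun _ => (toConfig x).one_mem⟩
  | append_singleton L σ ih =>
    have hL' : FreeGroup.IsReduced L := hL.infix ⟨[], [σ], by simp⟩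
    simp only [List.length_append, List.length_singleton] at hLn
    have key : ∀ f : Transition Ω n, f.dir = some σ → ∀ x', Cross f x x' →
        (FreeGroup.mk (L ++ [σ]) ∈ (toConfig x).carrier ↔
          FreeGroup.mk (L ++ [σ]) ∈ e.src.carrier) := by
      intro f hf x' hx'
      have h1 := ih hL' (by omega) (hx'.isNode hx) hx'.symm.mem
      have h2 : f.src = e.src := (hx.isStar he).src_eq f (mem_localConfig_one.2 hx'.mem)
      have h3 := hx'.movesTo_toConfig hx hf
      rw [← FreeGroup.mul_mk, ← h3, h1, ← h2, src_rev]
      obtain ⟨ζ, hζ, ζ', H, h4, h5⟩ := f.realized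
      rw [hf] at H
      rw [← h4, ← h5, mem_trunc, mem_trunc, H]
      refine and_congr Iff.rfl ?_
      rw [FreeGroup.mul_mk]
      -- Both words have length at most `n`, so the truncations impose nothing.
      refine iff_of_true ?_ ?_
      · exact FreeGroup.norm_mk_le.trans (by omega)
      · exact FreeGroup.norm_mk_le.trans (by simpa using hLn)
    constructor
    · intro h
      obtain ⟨f, hf, x', hx'⟩ := (mk_singleton_mem_toConfig hx).1 ((toConfig x).convex L [σ] hL h)
      exact (key f hf x' hx').1 h
    · intro h
      obtain ⟨f, hf, hf'⟩ := (exists_dir_eq_iff hn e (some σ)).2 (e.src.convex L [σ] hL h)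
      obtain ⟨t, ht, ht'⟩ := (hx.isStar he).complete f hf
      obtain ⟨x', hx'⟩ := hx.exists_cross (mem_localConfig_one.1 ht)
      exact (key t (ht'.trans hf') x' hx').2 h

theorem IsNode.trunc_toConfig (hn : 1 ≤ n) {x : ConvexConfig (Transition Ω n)} (hx : IsNode x)
    {e : Transition Ω n} (he : (FreeGroup.of e)⁻¹ ∈ x.carrier) : (toConfig x).trunc n = e.src := by
  have h : ∀ α : FreeGroup A, α.norm ≤ n →
      (α ∈ (toConfig x).carrier ↔ α ∈ e.src.carrier) := by
    intro α hα
    have := hx.mk_mem_toConfig_iff hn (FreeGroup.isReduced_toWord (x := α)) hα he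
    rwa [FreeGroup.mk_toWord] at this
  ext α
  rw [mem_trunc]
  constructor
  · rintro ⟨h1, h2⟩
    exact (h α h2).1 h1
  · intro h1
    have h2 : α.norm ≤ n := by
      obtain ⟨ζ, _, ζ', _, h3, _⟩ := e.realized
      rw [← h3] at h1
      exact h1.2
    exact ⟨(h α h2).2 h1, h2⟩

/-! ## The homomorphism between the free groups -/

variable (Ω n) in
/-- The homomorphism that follows the base points of unoriented transitions. -/
def hom : FreeGroup (Transition Ω n) →* FreeGroup A :=
  FreeGroup.lift fun e => (Dir.half e.dir)⁻¹

theorem hom_of (e : Transition Ω n) : hom Ω n (FreeGroup.of e) = (Dir.half e.dir)⁻¹ :=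
  FreeGroup.lift_apply_of

theorem hom_cross (e : Transition Ω n) :
    hom Ω n (FreeGroup.of e.rev * (FreeGroup.of e)⁻¹) = e.dir.elt := by
  rw [map_mul, map_inv, hom_of, hom_of, inv_inv, dir_rev, Dir.elt_eq]

theorem reach_nodeSystem {x y : ConvexConfig (Transition Ω n)} {g : FreeGroup (Transition Ω n)}
    {h : FreeGroup A} (hx : IsNode x) (H : (nodeSystem Ω n).Reach h (x, 1) (y, g)) :
    IsNode y ∧ MovesTo g x y ∧ hom Ω n g = h := by
  obtain ⟨L, rfl, H⟩ := H
  induction L generalizing y g with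
  | nil =>
    obtain ⟨rfl, rfl⟩ := Prod.mk.inj H
    exact ⟨hx, MovesTo.refl x, map_one _⟩
  | cons σ L ih =>
    obtain ⟨⟨y', g'⟩, h1, -, e, he, h2, h3⟩ := H
    obtain ⟨i1, i2, i3⟩ := ih h1
    simp only at h2 h3
    subst h3
    refine ⟨h2.isNode i1, i2.trans h2.movesTo, ?_⟩
    rw [map_mul, hom_cross, i3, he, Dir.elt, FreeGroup.mul_mk]
    rfl

theorem IsNode.reach {x y : ConvexConfig (Transition Ω n)} {g : FreeGroup (Transition Ω n)}
    (hx : IsNode x) (hy : IsNode y) (H : MovesTo g x y) :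
    (nodeSystem Ω n).Reach (hom Ω n g) (x, 1) (y, g) := by
  -- To allow induction letter by letter, a word ending at a midpoint is also covered: it is a path
  -- to a node `z` followed by a pending half-step `e⁻¹`.
  have key : ∀ L : List (Transition Ω n × Bool), FreeGroup.IsReduced L →
      ∀ y, MovesTo (FreeGroup.mk L) x y →
      (IsNode y → (nodeSystem Ω n).Reach (hom Ω n (FreeGroup.mk L)) (x, 1)
        (y, FreeGroup.mk L)) ∧
      (¬ IsNode y → ∃ e z, IsNode z ∧ MovesTo (FreeGroup.of e)⁻¹ z y ∧
        (nodeSystem Ω n).Reach (hom Ω n (FreeGroup.of e * FreeGroup.mk L)) (x, 1)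
          (z, FreeGroup.of e * FreeGroup.mk L)) := by
    intro L
    induction L with
    | nil =>
      intro _ y H
      obtain rfl := H.eq_of_one
      exact ⟨fun _ => by
        rw [← FreeGroup.one_eq_mk, map_one]; exact LetterSystem.Reach.refl _, fun h => absurd hx h⟩
    | cons σ L ih =>
      intro hL y H
      have e1 : FreeGroup.mk (σ :: L) = FreeGroup.mk [σ] * FreeGroup.mk L := by
        rw [FreeGroup.mul_mk]; rfl
      obtain ⟨y', h1⟩ := exists_movesTo (x.convex [σ] L hL H.mem)
      rw [e1] at H ⊢
      have h2 := h1.factor H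
      have hy' := mem_space_of_movesTo hx.1 h1
      have hy := mem_space_of_movesTo hx.1 H
      obtain ⟨ih1, ih2⟩ := ih (hL.infix ⟨[σ], [], by simp⟩) y' h1
      obtain ⟨e, b⟩ := σ
      cases b with
      | false =>
        rw [mk_false] at h2 ⊢
        have hn : IsNode y' := ⟨hy', e, h2.mem⟩
        refine ⟨fun h => absurd (by simpa using h2.symm.mem) (h.of_not_mem e), fun _ => ?_⟩
        refine ⟨e, y', hn, h2, ?_⟩
        rw [mul_inv_cancel_left]
        exact ih1 hn
      | true =>
        rw [mk_true] at h2 ⊢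
        have hn : IsNode y := ⟨hy, e, h2.symm.mem⟩
        refine ⟨fun _ => ?_, fun h => absurd hn h⟩
        obtain ⟨f, z, hz, h3, h4⟩ := ih2 fun h => h.of_not_mem e h2.mem
        have h5 : MovesTo (FreeGroup.of f) y' z := by simpa using h3.symm
        rcases (of_mem_iff hy' h5.mem e).1 h2.mem with rfl | rfl
        · rwa [h2.unique h5]
        · rcases hf : f.dir with _ | σ
          · rw [rev_eq_self.2 hf] at h2 ⊢
            rwa [h2.unique h5]
          · have h6 : (nodeSystem Ω n).Step σ (z, FreeGroup.of f * FreeGroup.mk L)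
                (y, FreeGroup.of f.rev * FreeGroup.mk L) :=
              ⟨hz, f, hf, ⟨y', h3, h2⟩, by simp [mul_assoc]⟩
            have h7 := h4.trans (LetterSystem.Reach.of_step h6)
            have h8 : FreeGroup.mk [σ] = hom Ω n (FreeGroup.of f.rev * (FreeGroup.of f)⁻¹) := by
              rw [hom_cross, hf]; rfl
            rw [h8, ← map_mul] at h7
            simpa [mul_assoc] using h7
  classical
  rw [← FreeGroup.mk_toWord (x := g)] at H ⊢
  exact (key _ FreeGroup.isReduced_toWord y H).1 hy

theorem IsNode.movesTo_toConfig {x y : ConvexConfig (Transition Ω n)}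
    {g : FreeGroup (Transition Ω n)} (hx : IsNode x) (hy : IsNode y) (H : MovesTo g x y) :
    MovesTo (hom Ω n g) (toConfig x) (toConfig y) := by
  have h := (hx.reach hy H).movesTo
  rwa [config_nodeSystem, config_nodeSystem] at h

/-- The letter system carries `g` in its state, and the state reached by a given element of `𝔽(A)`
is unique. -/
theorem IsNode.hom_injective {x y y' : ConvexConfig (Transition Ω n)}
    {g g' : FreeGroup (Transition Ω n)} (hx : IsNode x) (hy : IsNode y) (hy' : IsNode y')
    (H : MovesTo g x y) (H' : MovesTo g' x y') (h : hom Ω n g = hom Ω n g') : g = g' := by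
  have h1 := hx.reach hy H
  rw [h] at h1
  exact congrArg Prod.snd (h1.unique (hx.reach hy' H'))

theorem IsNode.exists_hom_eq {x : ConvexConfig (Transition Ω n)} (hx : IsNode x)
    {h : FreeGroup A} (hh : h ∈ (toConfig x).carrier) :
    ∃ g y, IsNode y ∧ MovesTo g x y ∧ hom Ω n g = h := by
  obtain ⟨⟨y, g⟩, H⟩ := hh
  obtain ⟨h1, h2, h3⟩ := reach_nodeSystem hx H
  exact ⟨g, y, h1, h2, h3⟩

/-- Every translate of the decoded configuration is decoded from a node, and its `n`-ball is the
source of a transition, hence occurs in `Ω`. -/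
theorem IsNode.toConfig_mem (hn : 1 ≤ n)
    (hΩ : ∀ ξ : ConvexConfig A,
      (∀ α η, MovesTo α ξ η → ∃ ζ ∈ Ω.space, η.trunc n = ζ.trunc n) → ξ ∈ Ω.space)
    {x : ConvexConfig (Transition Ω n)} (hx : IsNode x) : toConfig x ∈ Ω.space := by
  refine hΩ _ fun α η H => ?_
  obtain ⟨g, y, hy, h1, rfl⟩ := hx.exists_hom_eq H.mem
  obtain rfl := H.unique (hx.movesTo_toConfig hy h1)
  obtain ⟨e, he⟩ := hy.2
  obtain ⟨ζ, hζ, ζ', _, h, _⟩ := e.realized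
  exact ⟨ζ, hζ, (hy.trunc_toConfig hn he).trans h.symm⟩

/-- Used for continuity of `toConfig` on nodes. A letter acts through one of finitely many
transitions, so each further letter of the word adds a finite union of clopen preimages. -/
theorem exists_isClopen_mem_toConfig [Finite A] (α : FreeGroup A) :
    ∃ U : Set (ConvexConfig (Transition Ω n)), IsClopen U ∧
      ∀ x, IsNode x → (α ∈ (toConfig x).carrier ↔ x ∈ U) := by
  have key : ∀ L : List (A × Bool), FreeGroup.IsReduced L →
      ∃ U : Set (ConvexConfig (Transition Ω n)), IsClopen U ∧
        ∀ x, IsNode x → (FreeGroup.mk L ∈ (toConfig x).carrier ↔ x ∈ U) := by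
    intro L
    induction L using List.reverseRecOn with
    | nil => exact fun _ => ⟨Set.univ, isClopen_univ, fun x _ =>
        ⟨fun _ => trivial, fun _ => (toConfig x).one_mem⟩⟩
    | append_singleton L σ ih =>
      intro hL
      obtain ⟨U, hU, h⟩ := ih (hL.infix ⟨[], [σ], by simp⟩)
      refine ⟨⋃ e : {e : Transition Ω n // e.dir = some σ}, {x | ∃ y ∈ {y | ∃ x' ∈ U,
        MovesTo (FreeGroup.of e.1.rev) y x'}, MovesTo (FreeGroup.of e.1)⁻¹ x y},
        isClopen_iUnion_of_finite fun e => isClopen_preimage_movesTo _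
          (isClopen_preimage_movesTo _ hU), ?_⟩
      intro x hx
      rw [mk_append_singleton_mem hL, Set.mem_iUnion]
      constructor
      · rintro ⟨η, H, hη⟩
        obtain ⟨e, he, x', hx'⟩ := (mk_singleton_mem_toConfig hx).1 H.mem
        obtain rfl := H.unique (hx'.movesTo_toConfig hx he)
        have h1 := (h x' (hx'.isNode hx)).1 hη
        obtain ⟨y, h2, h3⟩ := hx'
        exact ⟨⟨e, he⟩, y, ⟨x', h1, h3⟩, h2⟩
      · rintro ⟨⟨e, he⟩, y, ⟨x', h1, h3⟩, h2⟩
        have hx' : Cross e x x' := ⟨y, h2, h3⟩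
        exact ⟨_, hx'.movesTo_toConfig hx he, (h x' (hx'.isNode hx)).2 h1⟩
  have := key _ (FreeGroup.isReduced_toWord (x := α))
  rwa [FreeGroup.mk_toWord] at this

end Transition

namespace Transition

variable {A : Type u} [DecidableEq A] {Ω : ConvexSubshift A} {n : ℕ}

/-! ## From the convex subshift to the separated graph -/

/-- The transition `e` leads from the node `ζ` to the midpoint of its unoriented transition, which
is recorded by its base point and its kind. -/
def Depart (e : Transition Ω n) (z z' : ConvexConfig A × Option (Option A)) : Prop :=
  z.2 = none ∧ IsLabel z.1 e ∧ MovesTo (Dir.half e.dir) z.1 z'.1 ∧ z'.2 = some e.dir.kind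

theorem Depart.unique {e : Transition Ω n} {z z₁ z₂ : ConvexConfig A × Option (Option A)}
    (h₁ : Depart e z z₁) (h₂ : Depart e z z₂) : z₁ = z₂ :=
  Prod.ext (h₁.2.2.1.unique h₂.2.2.1) (h₁.2.2.2.trans h₂.2.2.2.symm)

theorem Depart.unique_left {e : Transition Ω n} {z z₁ z₂ : ConvexConfig A × Option (Option A)}
    (h₁ : Depart e z₁ z) (h₂ : Depart e z₂ z) : z₁ = z₂ :=
  Prod.ext (h₁.2.2.1.unique_left h₂.2.2.1) (h₁.1.trans h₂.1.symm)

theorem exists_depart {ζ : ConvexConfig A} {e : Transition Ω n} (h : IsLabel ζ e) :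
    ∃ z, Depart e (ζ, none) z := by
  obtain ⟨ζ', H, -⟩ := h.2.2
  obtain ⟨η, hη⟩ := exists_movesTo (Dir.half_mem H.mem)
  exact ⟨(η, some e.dir.kind), rfl, h, hη, rfl⟩

/-- Both end points of an unoriented transition have the same midpoint. -/
theorem Depart.rev {ζ ζ' : ConvexConfig A} {z : ConvexConfig A × Option (Option A)}
    {e : Transition Ω n} (h : Depart e (ζ, none) z) (H : MovesTo e.dir.elt ζ ζ') :
    Depart e.rev (ζ', none) z := by
  refine ⟨rfl, h.2.1.rev H, ?_, ?_⟩
  · have := H.symm.trans h.2.2.1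
    rw [Dir.elt_eq] at this
    simpa using this
  · rw [h.2.2.2, dir_rev, Dir.kind_rev]

/-- The end points of an unoriented transition are the only ones that lead to its midpoint. -/
theorem Depart.eq_or_eq {ζ ζ' : ConvexConfig A} {z y : ConvexConfig A × Option (Option A)}
    {e f : Transition Ω n} (h : Depart e (ζ, none) z) (H : MovesTo e.dir.elt ζ ζ')
    (h' : Depart f y z) : (f = e ∧ y = (ζ, none)) ∨ (f = e.rev ∧ y = (ζ', none)) := by
  obtain ⟨η, k⟩ := y
  obtain rfl : k = none := h'.1
  have h1 : e.dir.kind = f.dir.kind := Option.some_injective _ (h.2.2.2.symm.trans h'.2.2.2)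
  rcases Dir.eq_or_eq_rev_of_kind_eq h1 with h2 | h2
  · have h3 := h'.2.2.1
    rw [h2] at h3
    obtain rfl := h3.unique_left h.2.2.1
    exact Or.inl ⟨h'.2.1.eq h.2.1 h2, rfl⟩
  · have h3 := h'.2.2.1
    have h4 := h.rev H
    rw [h2] at h3
    obtain rfl := h3.unique_left h4.2.2.1
    exact Or.inr ⟨h'.2.1.eq h4.2.1 h2, rfl⟩

variable (Ω n) in
/-- The edges of the graph act on the nodes and midpoints of configurations of the subshift. -/
def midpointSystem : LetterSystem (Transition Ω n) (ConvexConfig A × Option (Option A)) where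
  Step σ z z' := match σ with
    | (e, false) => Depart e z z'
    | (e, true) => Depart e z' z
  step_unique := by
    rintro ⟨e, _ | _⟩ z z₁ z₂ h₁ h₂
    · exact h₁.unique h₂
    · exact h₁.unique_left h₂
  step_symm := by
    rintro e (_ | _) z z' h
    · exact h
    · exact h

/-- The configuration of the separated graph that is described by a configuration of `Ω`. -/
def ofConfig (Ω : ConvexSubshift A) (n : ℕ) (ζ : ConvexConfig A) :
    ConvexConfig (Transition Ω n) := (midpointSystem Ω n).config (ζ, none)

/-- The states that occur: nodes and midpoints. -/
def IsState (Ω : ConvexSubshift A) (n : ℕ) (z : ConvexConfig A × Option (Option A)) : Prop :=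
  (z.1 ∈ Ω.space ∧ z.2 = none) ∨ ∃ (e : Transition Ω n) (ζ : ConvexConfig A), Depart e (ζ, none) z

theorem isState_of_step {σ : Transition Ω n × Bool} {z z' : ConvexConfig A × Option (Option A)}
    (h : (midpointSystem Ω n).Step σ z z') : IsState Ω n z' := by
  obtain ⟨e, _ | _⟩ := σ
  · obtain ⟨ζ, k⟩ := z
    obtain rfl : k = none := h.1
    exact Or.inr ⟨e, ζ, h⟩
  · exact Or.inl ⟨h.2.1.1, h.1⟩

theorem step_node_iff {ζ : ConvexConfig A} {e : Transition Ω n} {b : Bool} :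
    (∃ z, (midpointSystem Ω n).Step (e, b) (ζ, none) z) ↔ b = false ∧ IsLabel ζ e := by
  cases b with
  | false => exact ⟨fun ⟨z, h⟩ => ⟨rfl, h.2.1⟩, fun h => exists_depart h.2⟩
  | true =>
    constructor
    · rintro ⟨z, h⟩
      exact absurd h.2.2.2 (by simp)
    · rintro ⟨h, -⟩
      cases h

theorem step_midpoint_iff {ζ : ConvexConfig A} {z : ConvexConfig A × Option (Option A)}
    {e f : Transition Ω n} {b : Bool} (h : Depart e (ζ, none) z) :
    (∃ z', (midpointSystem Ω n).Step (f, b) z z') ↔ b = true ∧ (f = e ∨ f = e.rev) := by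
  obtain ⟨ζ', H, -⟩ := h.2.1.2.2
  cases b with
  | false =>
    constructor
    · rintro ⟨z', h'⟩
      exact absurd (h'.1.symm.trans h.2.2.2) (by simp)
    · rintro ⟨h, -⟩
      cases h
  | true =>
    constructor
    · rintro ⟨z', h'⟩
      exact ⟨rfl, (h.eq_or_eq H h').imp And.left And.left⟩
    · rintro ⟨-, rfl | rfl⟩
      · exact ⟨_, h⟩
      · exact ⟨_, h.rev H⟩

theorem isStar_of_mem (hn : 1 ≤ n) {ζ : ConvexConfig A} (hζ : ζ ∈ Ω.space) :
    ∃ e : Transition Ω n, IsLabel ζ e ∧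
      IsStar {σ | ∃ z, (midpointSystem Ω n).Step σ (ζ, none) z} e := by
  -- Standing still is always possible and supplies a transition that names the ball.
  obtain ⟨e, -, he⟩ := exists_isLabel (n := n) (o := none) hζ (MovesTo.refl ζ)
  have key : ∀ (f : Transition Ω n) b, (f, b) ∈ {σ | ∃ z, (midpointSystem Ω n).Step σ (ζ, none) z} ↔
      b = false ∧ IsLabel ζ f := fun f b => step_node_iff
  refine ⟨e, he, ⟨fun f hf => ?_, fun f hf => ?_, fun f f' hf hf' h => ?_, fun f hf => ?_⟩⟩
  · exact absurd ((key _ _).1 hf).1 (by simp)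
  · exact ((key _ _).1 hf).2.2.1.symm.trans he.2.1
  · exact ((key _ _).1 hf).2.eq ((key _ _).1 hf').2 h
  · have h1 := (exists_dir_eq_iff hn e f.dir).1 ⟨f, hf, rfl⟩
    rw [← he.2.1] at h1
    obtain ⟨ζ', H⟩ := exists_movesTo h1.1
    obtain ⟨f', h2, h3⟩ := exists_isLabel (n := n) hζ H
    exact ⟨f', (key _ _).2 ⟨rfl, h3⟩, h2⟩

theorem ofConfig_mem (hn : 1 ≤ n) {ζ : ConvexConfig A} (hζ : ζ ∈ Ω.space) :
    ofConfig Ω n ζ ∈ (graph Ω n).space := by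
  rintro g ⟨z, H⟩
  rw [ofConfig, LetterSystem.localConfig_config H]
  have hz : IsState Ω n z := by
    obtain ⟨L, -, H⟩ := H
    cases L with
    | nil => obtain rfl := H; exact Or.inl ⟨hζ, rfl⟩
    | cons σ L => obtain ⟨y, -, h⟩ := H; exact isState_of_step h
  rcases hz with ⟨h1, h2⟩ | ⟨e, η, h⟩
  · obtain ⟨η, k⟩ := z
    obtain rfl : k = none := h2
    obtain ⟨e, -, he⟩ := isStar_of_mem hn h1
    exact isAllowed_iff.2 (Or.inr ⟨e, he⟩)
  · convert isAllowed_pair e using 1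
    ext ⟨f, b⟩
    refine (step_midpoint_iff h).trans ?_
    simp only [Set.mem_insert_iff, Set.mem_singleton_iff, Prod.mk.injEq]
    tauto

theorem inv_mem_ofConfig {ζ : ConvexConfig A} {e : Transition Ω n} :
    (FreeGroup.of e)⁻¹ ∈ (ofConfig Ω n ζ).carrier ↔ IsLabel ζ e := by
  rw [← mk_false, ofConfig, LetterSystem.mk_singleton_mem_config, step_node_iff]
  simp

theorem isNode_ofConfig (hn : 1 ≤ n) {ζ : ConvexConfig A} (hζ : ζ ∈ Ω.space) :
    IsNode (ofConfig Ω n ζ) := by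
  obtain ⟨e, he, -⟩ := isStar_of_mem hn hζ
  exact ⟨ofConfig_mem hn hζ, e, inv_mem_ofConfig.2 he⟩

theorem cross_ofConfig {ζ ζ' : ConvexConfig A} {e : Transition Ω n} (he : IsLabel ζ e)
    (H : MovesTo e.dir.elt ζ ζ') : Cross e (ofConfig Ω n ζ) (ofConfig Ω n ζ') := by
  obtain ⟨z, hz⟩ := exists_depart he
  have h1 : (midpointSystem Ω n).Step (e, false) (ζ, none) z := hz
  have h2 : (midpointSystem Ω n).Step (e.rev, true) z (ζ', none) := hz.rev H
  exact ⟨_, (LetterSystem.Reach.of_step h1).movesTo, (LetterSystem.Reach.of_step h2).movesTo⟩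

/-- The relation `z.1 = ofConfig Ω n ξ` is preserved by letters: a letter acting on `ξ` is a
crossing of the encoded node, and conversely. -/
theorem toConfig_ofConfig (hn : 1 ≤ n) {ζ : ConvexConfig A} (hζ : ζ ∈ Ω.space) :
    toConfig (ofConfig Ω n ζ) = ζ := by
  refine LetterSystem.config_eq (fun z ξ => ξ ∈ Ω.space ∧ z.1 = ofConfig Ω n ξ) ?_ ?_ ⟨hζ, rfl⟩
  · rintro ⟨x, g⟩ ξ σ ⟨hξ, h⟩
    simp only at h
    subst h
    constructor
    · intro h
      obtain ⟨ξ', H⟩ := exists_movesTo h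
      obtain ⟨e, he, he'⟩ := exists_isLabel (n := n) (o := some σ) hξ H
      rw [← show e.dir.elt = FreeGroup.mk [σ] by rw [he]; rfl] at H
      exact ⟨(_, _), isNode_ofConfig hn hξ, e, he, cross_ofConfig he' H, rfl⟩
    · rintro ⟨z', -, e, he, h1, -⟩
      obtain ⟨ξ', H, -⟩ := (inv_mem_ofConfig.1 h1.mem).2.2
      rw [he] at H
      exact H.mem
  · rintro ⟨x, g⟩ ξ σ ⟨x', g'⟩ ξ' ⟨hξ, h⟩ ⟨-, e, he, h1, -⟩ H
    simp only at h
    subst h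
    have h2 := inv_mem_ofConfig.1 h1.mem
    have h3 : MovesTo e.dir.elt ξ ξ' := by rw [he]; exact H
    exact ⟨Ω.mem_of_movesTo hξ H, h1.unique (cross_ofConfig h2 h3)⟩

theorem IsNode.movesTo_elt {x x' : ConvexConfig (Transition Ω n)} {e : Transition Ω n}
    (hx : IsNode x) (h : Cross e x x') : MovesTo e.dir.elt (toConfig x) (toConfig x') := by
  have := hx.movesTo_toConfig (h.isNode hx) h.movesTo
  rwa [hom_cross] at this

/-- An edge at `x` is a label since the recorded balls at both of its ends are the true ones.
Conversely, the star of `x` contains some transition in the direction of the label `e`; it is a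
label as well, hence equal to `e`. -/
theorem IsNode.isLabel_toConfig_iff (hn : 1 ≤ n) {x : ConvexConfig (Transition Ω n)}
    (hx : IsNode x) (hxΩ : toConfig x ∈ Ω.space) {e : Transition Ω n} :
    (FreeGroup.of e)⁻¹ ∈ x.carrier ↔ IsLabel (toConfig x) e := by
  have key : ∀ f : Transition Ω n, (FreeGroup.of f)⁻¹ ∈ x.carrier → IsLabel (toConfig x) f := by
    intro f hf
    obtain ⟨x', hx'⟩ := hx.exists_cross hf
    exact ⟨hxΩ, hx.trunc_toConfig hn hf, _, hx.movesTo_elt hx',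
      (hx'.isNode hx).trunc_toConfig hn hx'.symm.mem⟩
  refine ⟨key e, fun h => ?_⟩
  obtain ⟨f, hf⟩ := hx.2
  have h1 : e.src = f.src := h.2.1.symm.trans (hx.trunc_toConfig hn hf)
  obtain ⟨t, ht, ht'⟩ := (hx.isStar hf).complete e h1
  have ht := mem_localConfig_one.1 ht
  rwa [h.eq (key t ht) ht'.symm]

theorem ofConfig_toConfig (hn : 1 ≤ n)
    (hΩ : ∀ x : ConvexConfig (Transition Ω n), IsNode x → toConfig x ∈ Ω.space)
    {x : ConvexConfig (Transition Ω n)} (hx : IsNode x) : ofConfig Ω n (toConfig x) = x := by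
  -- The bisimulation pairs nodes with nodes, and midpoints with midpoints reached along the same
  -- edge from paired nodes.
  refine LetterSystem.config_eq (fun z y => (IsNode y ∧ z = (toConfig y, none)) ∨
    ∃ x e, IsNode x ∧ MovesTo (FreeGroup.of e)⁻¹ x y ∧ Depart e (toConfig x, none) z)
    ?_ ?_ (Or.inl ⟨hx, rfl⟩)
  · rintro z y ⟨f, b⟩ (⟨hy, rfl⟩ | ⟨x, e, hx, H, h⟩)
    · rw [step_node_iff, ← hy.isLabel_toConfig_iff hn (hΩ y hy)]
      cases b with
      | false => simp [mk_false]
      | true => simpa [mk_true] using hy.of_not_mem f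
    · rw [step_midpoint_iff h]
      have hy := mem_space_of_movesTo hx.1 H
      have he : FreeGroup.of e ∈ y.carrier := by simpa using H.symm.mem
      cases b with
      | false => simpa [mk_false] using not_inv_of_mem hy he f
      | true => simpa [mk_true] using of_mem_iff hy he f
  · rintro z y ⟨f, b⟩ z' y' (⟨hy, rfl⟩ | ⟨x, e, hx, H, h⟩) hs H'
    · obtain ⟨rfl, -⟩ := step_node_iff.1 ⟨z', hs⟩
      exact Or.inr ⟨y, f, hy, H', hs⟩
    · obtain ⟨rfl, -⟩ := (step_midpoint_iff h).1 ⟨z', hs⟩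
      left
      have he : MovesTo (FreeGroup.of e) y x := by simpa using H.symm
      obtain ⟨x', hx'⟩ := hx.exists_cross H.mem
      rcases h.eq_or_eq (hx.movesTo_elt hx') hs with ⟨rfl, rfl⟩ | ⟨rfl, rfl⟩
      · obtain rfl := H'.unique he
        exact ⟨hx, rfl⟩
      · have hn' := hx'.isNode hx
        obtain ⟨t, h1, h2⟩ := hx'
        obtain rfl := h1.unique H
        obtain rfl := H'.unique h2
        exact ⟨hn', rfl⟩

end Transition

/-! ### Topology of the nodes and the Kakutani equivalence -/

namespace Transition

variable {A : Type u} [DecidableEq A] {Ω : ConvexSubshift A} {n : ℕ}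

/-- There are finitely many edges, so the condition at each `α` depends on finitely many
coordinates. -/
theorem isClosed_space [Finite A] : IsClosed (graph Ω n).space := by
  have e : (graph Ω n).space = ⋂ α : FreeGroup (Transition Ω n),
      {x | α ∈ x.carrier → (graph Ω n).IsAllowed (localConfig x α)} := by
    ext x
    simp [BipartiteSeparatedGraph.space]
  rw [e]
  refine isClosed_iInter fun α => IsClopen.isClosed ?_
  refine isClopen_of_finite (S := insert α (Set.range fun σ : Transition Ω n × Bool =>
    FreeGroup.mk [σ] * α)) ((Set.finite_range _).insert α) ?_
  intro x y h hx hy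
  have : localConfig x α = localConfig y α := by
    ext σ
    exact h _ (Set.mem_insert_of_mem _ ⟨σ, rfl⟩)
  rw [← this]
  exact hx ((h α (Set.mem_insert _ _)).2 hy)

/-- The set of nodes in the space of the separated graph. -/
def nodes (Ω : ConvexSubshift A) (n : ℕ) : Set (graph Ω n).space := {x | IsNode x.1}

theorem isClopen_nodes [Finite A] : IsClopen (nodes Ω n) := by
  have h : IsClopen (⋃ e : Transition Ω n, {x : ConvexConfig (Transition Ω n) |
      (FreeGroup.of e)⁻¹ ∈ x.carrier}) := isClopen_iUnion_of_finite fun e => isClopen_mem _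
  convert h.preimage (continuous_subtype_val (p := (· ∈ (graph Ω n).space))) using 1
  ext x
  simp only [nodes, Set.mem_ofPred_eq, Set.mem_preimage, Set.mem_iUnion]
  exact ⟨fun h => h.2, fun h => ⟨x.2, h⟩⟩

/-- A midpoint `y` contains some edge `e`; then `e.y` is a node, and `e⁻¹` moves it back to `y`. -/
theorem isFull_nodes : (graph Ω n).action.IsFull (nodes Ω n) := by
  intro y
  by_cases hy : IsNode y.1
  · exact ⟨1, y, (graph Ω n).action.mem_src_one y, hy, (graph Ω n).action.act_one y _⟩
  · obtain ⟨e, he⟩ := exists_of_mem_of_not_isNode y.2 hy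
    obtain ⟨x, hx⟩ := exists_movesTo he
    have hxs := mem_space_of_movesTo y.2 hx
    refine ⟨(FreeGroup.of e)⁻¹, ⟨x, hxs⟩, ?_, ⟨hxs, e, hx.symm.mem⟩, ?_⟩
    · refine ⟨hx.symm.mem, ?_⟩
      exact mem_space_of_movesTo hxs (movesTo_shift x _ hx.symm.mem)
    · exact Subtype.ext ((movesTo_shift x _ hx.symm.mem).unique hx.symm)

/-- The nodes of the separated graph are the configurations of the subshift. -/
noncomputable def nodesEquiv (hn : 1 ≤ n)
    (hΩ : ∀ x : ConvexConfig (Transition Ω n), IsNode x → toConfig x ∈ Ω.space) :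
    nodes Ω n ≃ (Set.univ : Set Ω.space) where
  toFun x := ⟨⟨toConfig x.1.1, hΩ _ x.2⟩, trivial⟩
  invFun ζ := ⟨⟨ofConfig Ω n ζ.1.1, ofConfig_mem hn ζ.1.2⟩, isNode_ofConfig hn ζ.1.2⟩
  left_inv x := Subtype.ext (Subtype.ext (ofConfig_toConfig hn hΩ x.2))
  right_inv ζ := Subtype.ext (Subtype.ext (toConfig_ofConfig hn ζ.1.2))

theorem continuous_nodesEquiv [Finite A] (hn : 1 ≤ n)
    (hΩ : ∀ x : ConvexConfig (Transition Ω n), IsNode x → toConfig x ∈ Ω.space) :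
    Continuous (nodesEquiv hn hΩ) := by
  refine Continuous.subtype_mk (Continuous.subtype_mk ?_ _) _
  refine continuous_induced_rng.2 (continuous_pi fun α => ?_)
  obtain ⟨U, hU, h⟩ := exists_isClopen_mem_toConfig (Ω := Ω) (n := n) α
  have e : (fun x : nodes Ω n => (toConfig x.1.1).carrier.boolIndicator α) =
      fun x => U.boolIndicator x.1.1 := by
    funext x
    rw [Bool.eq_iff_iff, ← Set.mem_iff_boolIndicator, ← Set.mem_iff_boolIndicator]
    exact h _ x.2
  exact e ▸ ((continuous_boolIndicator_iff_isClopen U).2 hU).comp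
    (continuous_subtype_val.comp continuous_subtype_val)

theorem kakutaniEquivalent [Finite A] (hn : 1 ≤ n)
    (hΩ : ∀ x : ConvexConfig (Transition Ω n), IsNode x → toConfig x ∈ Ω.space) :
    KakutaniEquivalent (graph Ω n).action Ω.action := by
  refine ⟨nodes Ω n, Set.univ, isClopen_nodes, isClopen_univ, isFull_nodes, fun y =>
    ⟨1, y, Ω.action.mem_src_one y, trivial, Ω.action.act_one y _⟩, ?_⟩
  have : CompactSpace (graph Ω n).space := isCompact_iff_compactSpace.1 isClosed_space.isCompact
  have : CompactSpace (nodes Ω n) :=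
    isCompact_iff_compactSpace.1 isClopen_nodes.isClosed.isCompact
  -- A continuous bijection from a compact space to a Hausdorff space is a homeomorphism, so
  -- continuity of `ofConfig` needs no separate argument.
  refine DynamicalEquivalence.nonempty_of_monoidHom _ _
    ((continuous_nodesEquiv hn hΩ).homeoOfEquivCompactToT2) (hom Ω n) ?_ ?_ ?_
  · rintro g x ⟨⟨hg, hs⟩, hx⟩
    have H := IsNode.movesTo_toConfig x.2 hx (movesTo_shift x.1.1 g hg)
    exact ⟨⟨⟨H.mem, Ω.mem_of_movesTo (hΩ _ x.2) (movesTo_shift _ _ H.mem)⟩, trivial⟩,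
      Subtype.ext (Subtype.ext H.eq_shift)⟩
  · rintro x h ⟨⟨hh, -⟩, -⟩
    obtain ⟨g, y, hy, H, rfl⟩ := IsNode.exists_hom_eq x.2 hh
    rw [H.eq_shift] at hy
    exact ⟨g, ⟨⟨H.mem, hy.1⟩, hy⟩, rfl⟩
  · rintro x g g' ⟨⟨hg, _⟩, hx⟩ ⟨⟨hg', _⟩, hx'⟩ h
    exact IsNode.hom_injective x.2 hx hx' (movesTo_shift x.1.1 g hg)
      (movesTo_shift x.1.1 g' hg') h

end Transition

theorem theorem3p14 {A : Type u} [Finite A] [DecidableEq A]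
    (Ω : ConvexSubshift A) (hΩ : Ω.IsFiniteType) :
    ∃ (V E : Type u) (_ : Finite V) (_ : Finite E) (𝓔 : BipartiteSeparatedGraph V E),
      KakutaniEquivalent 𝓔.action Ω.action := by
  obtain ⟨n, hn, h⟩ := hΩ.exists_radius
  exact ⟨Transition.Vertex Ω n, Transition Ω n, inferInstance, inferInstance,
    Transition.graph Ω n,
    Transition.kakutaniEquivalent hn fun x hx => hx.toConfig_mem hn h⟩
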